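/- Let $\mathcal O$ be a UFD containing an uncountable field $\Bbbk$ of characteristic zero, let $\mathbb L$ be its fraction field and $\mathcal K$ an algebraic closure of $\mathbb L$. Write $\mathbf x=(x_1,\dots,x_n)$, $\mathbf x'=(x_1,\dots,x_{n-1})$. For $f\in\mathcal O\setminus\{0\}$ let $\mathcal O_f=\mathcal O[1/f]\subset\mathcal K$, and for $\mathfrak c\in\mathcal K$ let $\mathcal O_f[\![\mathbf x]\!][\mathfrak c]\subset\mathcal K[\![\mathbf x]\!]$ be the subring generated by $\mathcal O_f[\![\mathbf x]\!]$ and $\mathfrak c$. For every $n\ge 0$ put $$\mathcal K\{\!\{x_1,\dots,x_n\}\!\}:=\bigcup_{\mathfrak c\in\mathcal K}\ \bigcup_{f\in\mathcal O\setminus\{0\}}\mathcal O_f[\![x_1,\dots,x_n]\!][\mathfrak c]$$ (the Eisenstein series over $\mathcal O$). Then the following hold. **(1)** $\mathcal K$ is an uncountable algebraically closed field of characteristic zero, and $(\mathcal K\{\!\{x_1,\dots,x_n\}\!\})_{n}$ is a W-temperate family over $\mathcal K$. That is, it is a Weierstrass family: * $\mathcal K\{\!\{\mathbf x\}\!\}$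 is a $\mathcal K$-subalgebra of $\mathcal K[\![\mathbf x]\!]$ containing $\mathcal K[\mathbf x]$; * $\mathcal K\{\!\{\mathbf x,\mathbf y\}\!\}\cap\mathcal K[\![\mathbf x]\!]=\mathcal K\{\!\{\mathbf x\}\!\}$ for finite tuples of variables $\mathbf x,\mathbf y$; * $\mathcal K\{\!\{\mathbf x\}\!\}$ is stable under permutations of the variables; * every $f\in\mathcal K\{\!\{\mathbf x\}\!\}$ with $f(0)\ne0$ is a unit of $\mathcal K\{\!\{\mathbf x\}\!\}$; * for $n\ge1$, if $F\in\mathcal K\{\!\{\mathbf x\}\!\}$ satisfies $F(0,x_n)=x_n^d u(x_n)$ with $u(0)\neq0$, then for every $G\in\mathcal K\{\!\{\mathbf x\}\!\}$ there are unique $Q\in\mathcal K\{\!\{\mathbf x\}\!\}$ and $R\in\mathcal K\{\!\{\mathbf x'\}\!\}[x_n]$ with $\deg_{x_n}R<d$ and $G=FQ+R$; and it satisfies moreover: * for $n\ge2$ and $f\in\mathcal K[\![\mathbf x]\!]$, if $f(\mathbf x',x_1x_n)\in\mathcal K\{\!\{\mathbf x\}\!\}$ then $f\in\mathcal K\{\!\{\mathbf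 x\}\!\}$; * for $n\ge2$ and $F\in\mathcal K[\![\mathbf x]\!]\setminus\mathcal K\{\!\{\mathbf x\}\!\}$, the set of $\lambda\in\mathcal K$ with $F(\mathbf x',\lambda x_1)\notin\mathcal K\{\!\{\mathbf x'\}\!\}$ is uncountable; * let $\alpha\ge1$ be an integer, let $\Gamma\in\mathcal K[t,z]$ be irreducible, monic in $z$ and split in $\mathcal K\{\!\{t\}\!\}[z]$, let $\gamma,\gamma'\in\mathcal K\{\!\{t\}\!\}$ be roots of $\Gamma$, and let $P=\sum_{k\ge0}x_1^kp_k(x_2,z)\in\mathcal K[\![x_1,x_2]\!][z]$ with $p_k\in\mathcal K[x_2,z]$ and $\deg_{x_2}p_k\le\alpha k$ for all $k$; if $P(x_1,x_2,\gamma(x_2))\in\mathcal K\{\!\{x_1,x_2\}\!\}$, then $P(x_1,x_2,\gamma'(x_2))\in\mathcal K\{\!\{x_1,x_2\}\!\}$. **(2)** (Weierstrass division with control of coefficients.) Let $n\ge1$, $\mathfrak c\in\mathcal K$, $f\in\mathcal O\setminus\{0\}$, and let $F\in\mathcal O_f[\![\mathbf x]\!][\mathfrak c]$ satisfy $F(0,x_n)=x_n^du(x_n)$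 with $u(0)\ne0$. Then there is a nonzero multiple $g\in\mathcal O$ of $f$ such that $u(0)$ is a unit of $\mathcal O_g[\mathfrak c]$. Moreover, for every nonzero multiple $g$ of $f$ with this property and every $G\in\mathcal O_g[\![\mathbf x]\!][\mathfrak c]$, there are unique $Q\in\mathcal K[\![\mathbf x]\!]$ and $R\in\mathcal K[\![\mathbf x']\!][x_n]$ with $\deg_{x_n}R<d$ and $G=FQ+R$, and all coefficients of $Q$ and $R$ belong to $\mathcal O_g[\mathfrak c]$. **(3)** For every $n\ge2$ and every $F\in\mathcal K[\![\mathbf x]\!]\setminus\mathcal K\{\!\{\mathbf x\}\!\}$, the set $\{\lambda\in\Bbbk\mid F(\mathbf x',\lambda x_1)\in\mathcal K\{\!\{\mathbf x'\}\!\}\}$ is countable. -/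

import Mathlib

/-!
Families of rings of power series are given as `A : ∀ n, Set (MvPowerSeries (Fin n) K)`, with
`A n` playing the role of `K{{x₁,…,xₙ}}`. The variable `x₁` is `X 0`, and in `n + 1` variables
the last variable is `X (Fin.last n)`. All substitutions below have zero constant terms.
-/

namespace WFamily

open MvPowerSeries

section Families

variable {K : Type*} [Field K]

/-- `F(0, xₙ)`, as a power series in one variable (here `F` has `n + 1` variables). -/
noncomputable def restrictLast {n : ℕ} (F : MvPowerSeries (Fin (n + 1)) K) : PowerSeries K :=
  PowerSeries.mk fun j => coeff (Finsupp.single (Fin.last n) j) F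

/-- The embedding `K⟦x'⟧[z] → K⟦x', xₙ⟧` sending `z` to the last variable. -/
noncomputable def polyInLast (K : Type*) [Field K] (n : ℕ) :
    Polynomial (MvPowerSeries (Fin n) K) →+* MvPowerSeries (Fin (n + 1)) K :=
  Polynomial.eval₂RingHom (rename (R := K) (Fin.castSucc : Fin n → Fin (n + 1))).toRingHom
    (X (Fin.last n))

/-- The substitution `F(x', x₁ xₙ)`, in `n + 2 ≥ 2` variables. -/
noncomputable def blowDown {n : ℕ} (F : MvPowerSeries (Fin (n + 2)) K) :
    MvPowerSeries (Fin (n + 2)) K :=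
  subst (fun i : Fin (n + 2) =>
    if i = Fin.last (n + 1) then (X 0 * X (Fin.last (n + 1)) : MvPowerSeries (Fin (n + 2)) K)
    else X i) F

/-- The restriction `F(x', a x₁)` of a series in `n + 2 ≥ 2` variables to the hyperplane
`xₙ = a x₁`, a series in one variable less. -/
noncomputable def hyperplaneSection {n : ℕ} (a : K) (F : MvPowerSeries (Fin (n + 2)) K) :
    MvPowerSeries (Fin (n + 1)) K :=
  subst (Fin.lastCases (C a * X 0 : MvPowerSeries (Fin (n + 1)) K) (fun i => X i)) F

/-- The embedding `K[t] → K⟦t⟧`. -/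
noncomputable def polyToSeries (K : Type*) [Field K] :
    Polynomial K →+* MvPowerSeries (Fin 1) K :=
  (Polynomial.aeval (X 0 : MvPowerSeries (Fin 1) K)).toRingHom

/-- `γ(t) ↦ γ(x₂)`, from `K⟦t⟧` to `K⟦x₁, x₂⟧`. -/
noncomputable def inSecond (γ : MvPowerSeries (Fin 1) K) : MvPowerSeries (Fin 2) K :=
  rename (fun _ : Fin 1 => (1 : Fin 2)) γ

/-- `(A n)` is a Weierstrass family of rings over `K`. -/
structure IsWeierstrassFamily (K : Type*) [Field K]
    (A : ∀ n : ℕ, Set (MvPowerSeries (Fin n) K)) : Prop where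
  charZero : CharZero K
  isSubalgebra : ∀ n, ∃ S : Subalgebra K (MvPowerSeries (Fin n) K), (S : Set _) = A n
  polynomial_mem : ∀ n (p : MvPolynomial (Fin n) K), (p : MvPowerSeries (Fin n) K) ∈ A n
  /-- `K{{x, y}} ∩ K⟦x⟧ = K{{x}}` -/
  inter_eq : ∀ n m (f : MvPowerSeries (Fin n) K), rename (Fin.castAdd m) f ∈ A (n + m) ↔ f ∈ A n
  perm_mem : ∀ n (σ : Equiv.Perm (Fin n)), ∀ f ∈ A n, rename σ f ∈ A n
  unit : ∀ n, ∀ f ∈ A n, constantCoeff f ≠ 0 → ∃ g ∈ A n, f * g = 1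
  /-- Weierstrass division by a series that is regular of order `d` in the last variable. -/
  division : ∀ n d : ℕ, ∀ F ∈ A (n + 1),
    (∃ u : PowerSeries K, PowerSeries.constantCoeff u ≠ 0 ∧
      restrictLast F = PowerSeries.X ^ d * u) →
    ∀ G ∈ A (n + 1),
      ∃! QR : MvPowerSeries (Fin (n + 1)) K × Polynomial (MvPowerSeries (Fin n) K),
        QR.1 ∈ A (n + 1) ∧ (∀ i, QR.2.coeff i ∈ A n) ∧ QR.2.degree < d ∧
          G = F * QR.1 + polyInLast K n QR.2

/-- `(A n)` is a Weierstrass temperate family of rings over `K`. -/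
structure IsWTemperateFamily (K : Type*) [Field K]
    (A : ∀ n : ℕ, Set (MvPowerSeries (Fin n) K)) : Prop extends IsWeierstrassFamily K A where
  uncountable : Uncountable K
  isAlgClosed : IsAlgClosed K
  /-- Closure by local blowings-down. -/
  blowDown_mem : ∀ n (f : MvPowerSeries (Fin (n + 2)) K), blowDown f ∈ A (n + 2) → f ∈ A (n + 2)
  /-- Closure by generic hyperplane sections. -/
  hyperplane : ∀ n (F : MvPowerSeries (Fin (n + 2)) K), F ∉ A (n + 2) →
    ¬ ({a : K | hyperplaneSection a F ∈ A (n + 1)}ᶜ).Countable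
  /-- Temperateness. Elements of `K[t, z]` are polynomials in `z` over `K[t]`; the series
  `P = ∑ₖ x₁ᵏ pₖ(x₂, z)` is an element of `K⟦x₁, x₂⟧[z]`. -/
  temperate : ∀ (α : ℕ), 0 < α → ∀ Γ : Polynomial (Polynomial K), Irreducible Γ → Γ.Monic →
    (∃ s : Multiset (MvPowerSeries (Fin 1) K), (∀ g ∈ s, g ∈ A 1) ∧
      Γ.map (polyToSeries K) = (s.map fun g => Polynomial.X - Polynomial.C g).prod) →
    ∀ γ ∈ A 1, ∀ γ' ∈ A 1,
      Γ.eval₂ (polyToSeries K) γ = 0 → Γ.eval₂ (polyToSeries K) γ' = 0 →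
    ∀ (p : ℕ → Polynomial (Polynomial K)) (P : Polynomial (MvPowerSeries (Fin 2) K)),
      (∀ k j, ((p k).coeff j).natDegree ≤ α * k) →
      (∀ j (m : Fin 2 →₀ ℕ), coeff m (P.coeff j) = ((p (m 0)).coeff j).coeff (m 1)) →
      P.eval (inSecond γ) ∈ A 2 → P.eval (inSecond γ') ∈ A 2

end Families

section Eisenstein

variable (O K : Type*) [CommRing O] [Field K] [Algebra O K]

/-- `O_f = O[1/f]`, for `f ≠ 0`, as a subring of a field `K` that contains `O`. -/
def locAway (f : O) : Subalgebra O K := Algebra.adjoin O {(algebraMap O K f)⁻¹}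

/-- `O_f[c]`, as a subring of `K`. -/
def locAwayAdjoin (f : O) (c : K) : Subalgebra (locAway O K f) K :=
  Algebra.adjoin (locAway O K f) {c}

/-- `O_f⟦x₁, …, xₙ⟧`, as a subring of `K⟦x₁, …, xₙ⟧`. -/
noncomputable def seriesLocAway (n : ℕ) (f : O) : Subring (MvPowerSeries (Fin n) K) :=
  (MvPowerSeries.map (σ := Fin n) (locAway O K f).val.toRingHom).range

/-- `O_f⟦x₁, …, xₙ⟧[c]`, as a subring of `K⟦x₁, …, xₙ⟧`. -/
noncomputable def eisensteinAt (n : ℕ) (f : O) (c : K) :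
    Subalgebra (seriesLocAway O K n f) (MvPowerSeries (Fin n) K) :=
  Algebra.adjoin (seriesLocAway O K n f) {(C c : MvPowerSeries (Fin n) K)}

/-- The Eisenstein series over `O` in `n` variables: the union of the rings
`O_f⟦x₁, …, xₙ⟧[c]` over all `c ∈ K` and all nonzero `f ∈ O`. -/
def eisensteinSeries (n : ℕ) : Set (MvPowerSeries (Fin n) K) :=
  {F | ∃ (c : K) (f : O), f ≠ 0 ∧ F ∈ eisensteinAt O K n f c}

end Eisenstein

end WFamily

/-! Everything rests on one criterion: a series is Eisenstein exactly when its coefficients lie in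
one finitely generated `O`-subalgebra of `K` (`mem_eisensteinSeries_iff`). The primitive element
theorem puts such an algebra inside some `O[1/f, c]` with `c` integral over `O`; over `O_f` this
ring is spanned by boundedly many powers of `c`, so coefficientwise expansions assemble into an
element of `O_f⟦x⟧[c]`. The algebraic axioms then reduce to adjoining finitely many elements.
Weierstrass division is a triangular recursion that divides only by the leading coefficient, which
also gives the control of coefficients in (2).

For hyperplane sections, each coefficient of `F(x', a x₁)` is a polynomial in `a` whose coefficients
are coefficients of `F`. Suppose uncountably many `a` in `k` give Eisenstein sections. A pigeonhole
over finite sets of exponents, followed by interpolation in `a`, shows that the coefficients of `F`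
span a finite-dimensional `L`-space. A second pigeonhole, for each coordinate of that space, bounds
their denominators. There may be uncountably many rings `O_f`, but unique factorization leaves only
countably many relevant ones (`exists_denominators`). Hence `F` is Eisenstein.

For temperateness, replacing `p_k` by its remainder `r_k` modulo `Γ` changes no value at a root of
`Γ`. It remains to bound the coefficients of all the `r_k` from their values at `γ`
(`exists_fg_coeff_mem`). Let `V` be a valuation ring containing a suitable `O_f`. If some
coefficient of `r_k` were outside `V`, then `r_k` divided by its largest coefficient would reduce to
a nonzero polynomial of degree less than `deg Γ` that vanishes at a root of the reduced `Γ`. Then a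
proper partial product of the reduced linear factors would be a polynomial of small degree in `t`;
inverting finitely many coefficients in advance excludes this. So the coefficients of the `r_k` are
integral over `O_f`. They also lie in a fixed finite extension of `L`, where the integral elements
are contained in a finitely generated algebra. -/

namespace WFamily

open MvPowerSeries

/-! ### Coefficients of the substitutions -/

section Exponents

variable {n : ℕ}

/-- The exponent of the first `n` variables. -/
noncomputable def initExp (m : Fin (n + 1) →₀ ℕ) : Fin n →₀ ℕ :=
  Finsupp.equivFunOnFinite.symm fun i => m i.castSucc

/-- The exponent with the first `n` entries `m` and the last entry `j`. -/
noncomputable def snocExp (m : Fin n →₀ ℕ) (j : ℕ) : Fin (n + 1) →₀ ℕ :=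
  Finsupp.equivFunOnFinite.symm (Fin.snoc (α := fun _ => ℕ) m j)

@[simp] lemma initExp_apply (m : Fin (n + 1) →₀ ℕ) (i : Fin n) : initExp m i = m i.castSucc := rfl

@[simp] lemma snocExp_castSucc (m : Fin n →₀ ℕ) (j : ℕ) (i : Fin n) :
    snocExp m j i.castSucc = m i := by simp [snocExp]

@[simp] lemma snocExp_last (m : Fin n →₀ ℕ) (j : ℕ) : snocExp m j (Fin.last n) = j := by
  simp [snocExp]

@[simp] lemma initExp_snocExp (m : Fin n →₀ ℕ) (j : ℕ) : initExp (snocExp m j) = m := by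
  ext i; simp

@[simp] lemma snocExp_initExp (m : Fin (n + 1) →₀ ℕ) :
    snocExp (initExp m) (m (Fin.last n)) = m := by
  ext i; refine Fin.lastCases ?_ (fun i => ?_) i <;> simp

lemma initExp_add (a b : Fin (n + 1) →₀ ℕ) : initExp (a + b) = initExp a + initExp b := by
  ext i; simp

lemma exp_ext {a b : Fin (n + 1) →₀ ℕ} (h : initExp a = initExp b)
    (h' : a (Fin.last n) = b (Fin.last n)) : a = b := by
  rw [← snocExp_initExp a, ← snocExp_initExp b, h, h']

lemma single_last_eq_snocExp (j : ℕ) : Finsupp.single (Fin.last n) j = snocExp 0 j := by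
  ext i; refine Fin.lastCases ?_ (fun i => ?_) i
  · simp
  · simp

@[simp] lemma initExp_single_last (j : ℕ) : initExp (Finsupp.single (Fin.last n) j) = 0 := by
  rw [single_last_eq_snocExp]; simp

lemma mapDomain_castSucc (m : Fin n →₀ ℕ) :
    Finsupp.mapDomain Fin.castSucc m = snocExp m 0 := by
  ext i; refine Fin.lastCases ?_ (fun i => ?_) i
  · rw [Finsupp.mapDomain_of_notMem_range]; · simp
    rintro ⟨j, hj⟩; exact (Fin.castSucc_lt_last j).ne hj
  · rw [Finsupp.mapDomain_apply (Fin.castSucc_injective n)]; simp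

end Exponents

section Coefficients

variable {K : Type*} [Field K]

lemma coeff_rename_castSucc {n : ℕ} (f : MvPowerSeries (Fin n) K) (m : Fin (n + 1) →₀ ℕ) :
    coeff m (rename (Fin.castSucc : Fin n → Fin (n + 1)) f) =
      if m (Fin.last n) = 0 then coeff (initExp m) f else 0 := by
  split_ifs with h
  · have := coeff_embDomain_rename (R := K) (Fin.castSuccEmb : Fin n ↪ Fin (n + 1)) f (initExp m)
    rw [Finsupp.embDomain_eq_mapDomain] at this
    have hm : Finsupp.mapDomain Fin.castSuccEmb (initExp m) = m := by
      change Finsupp.mapDomain Fin.castSucc _ = m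
      rw [mapDomain_castSucc, ← h, snocExp_initExp]
    rw [← this, hm]; rfl
  · apply coeff_rename_eq_zero
    rintro ⟨x, rfl⟩
    rw [mapDomain_castSucc] at h
    simp at h

lemma coeff_polyInLast {n : ℕ} (R : Polynomial (MvPowerSeries (Fin n) K))
    (m : Fin (n + 1) →₀ ℕ) :
    coeff m (polyInLast K n R) = coeff (initExp m) (R.coeff (m (Fin.last n))) := by
  induction R using Polynomial.induction_on' with
  | add p q hp hq => simp [hp, hq]
  | monomial i a =>
    have : polyInLast K n (Polynomial.monomial i a) =
        rename (Fin.castSucc : Fin n → Fin (n + 1)) a * X (Fin.last n) ^ i := by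
      simp [polyInLast]
    rw [this, X_pow_eq, coeff_mul_monomial, Polynomial.coeff_monomial, mul_one,
      coeff_rename_castSucc]
    simp only [Finsupp.single_le_iff]
    by_cases h : i = m (Fin.last n)
    · subst h
      simp only [le_refl, if_true, Finsupp.tsub_apply, Finsupp.single_eq_same, tsub_self]
      rw [show initExp (m - Finsupp.single (Fin.last n) (m (Fin.last n))) = initExp m by
        ext j; simp]
    · rw [if_neg h]
      split_ifs with h1 h2
      · simp at h2; omega
      · simp
      · simp

/-- Each monomial is sent to a multiple of a monomial, and the exponents sent to `e` are indexed by
the power `j ≤ e 0` of the last variable. Thus the coefficient is a polynomial in `a`, which is what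
makes interpolation possible. -/
lemma coeff_hyperplaneSection {n : ℕ} (a : K) (F : MvPowerSeries (Fin (n + 2)) K)
    (e : Fin (n + 1) →₀ ℕ) :
    coeff e (hyperplaneSection a F) =
      ∑ j ∈ Finset.range (e 0 + 1), a ^ j * coeff (snocExp (e - Finsupp.single 0 j) j) F := by
  classical
  rw [hyperplaneSection, coeff_subst]
  swap
  · apply hasSubst_of_constantCoeff_zero
    intro s; refine Fin.lastCases ?_ (fun i => ?_) s <;> simp
  have key : ∀ d : Fin (n + 2) →₀ ℕ, (d.prod fun s k => (Fin.lastCases (motive := fun _ =>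
      MvPowerSeries (Fin (n + 1)) K) (C a * X 0) (fun i => X i) s) ^ k) =
      monomial (initExp d + Finsupp.single 0 (d (Fin.last _))) (a ^ (d (Fin.last _))) := by
    intro d
    rw [Finsupp.prod_fintype _ _ (by simp), Fin.prod_univ_castSucc]
    have h1 : (∏ i : Fin (n + 1), (X i : MvPowerSeries (Fin (n + 1)) K) ^ d i.castSucc) =
        monomial (initExp d) 1 := by
      rw [monomial_one_eq, Finsupp.prod_fintype _ _ (by simp)]; simp
    simp only [Fin.lastCases_castSucc, Fin.lastCases_last, h1, mul_pow]
    rw [X_pow_eq, ← map_pow, mul_left_comm, monomial_mul_monomial, one_mul, ← smul_eq_C_mul, ← map_smul]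
    simp
  simp only [key, coeff_monomial, smul_eq_mul]
  have inj : Function.Injective fun j => snocExp (e - Finsupp.single 0 j) j := by
    intro i j h
    have := DFunLike.congr_fun h (Fin.last _)
    simpa using this
  rw [finsum_eq_sum_of_support_subset (s := (Finset.range (e 0 + 1)).image
    (fun j => snocExp (e - Finsupp.single 0 j) j)), Finset.sum_image inj.injOn]
  · refine Finset.sum_congr rfl fun j hj => ?_
    have : e = e - Finsupp.single 0 j + Finsupp.single 0 j := by
      rw [tsub_add_cancel_of_le]
      simpa [Nat.lt_succ_iff] using hj
    simp only [initExp_snocExp, snocExp_last, ← this, if_true, mul_comm]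
  · intro d hd
    simp only [Function.mem_support, ne_eq, mul_eq_zero, not_or, ite_eq_right_iff,
      Classical.not_imp] at hd
    obtain ⟨-, hd, -⟩ := hd
    simp only [Finset.coe_image, Set.mem_image, Finset.coe_range, Set.mem_Iio]
    refine ⟨d (Fin.last _), ?_, ?_⟩
    · rw [hd]; simp
    · rw [hd]; simp

/-- The substitution acts on exponents by an injective map, so every coefficient of `F` reappears
unchanged in `blowDown F`. -/
lemma coeff_blowDown {n : ℕ} (F : MvPowerSeries (Fin (n + 2)) K) (m : Fin (n + 2) →₀ ℕ) :
    coeff (m + Finsupp.single 0 (m (Fin.last _))) (blowDown F) = coeff m F := by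
  classical
  rw [blowDown, coeff_subst]
  swap
  · apply hasSubst_of_constantCoeff_zero
    intro s; split_ifs <;> simp
  have key : ∀ d : Fin (n + 2) →₀ ℕ, (d.prod fun s k => (if s = Fin.last (n + 1) then
      (X 0 * X (Fin.last (n + 1)) : MvPowerSeries (Fin (n + 2)) K) else X s) ^ k) =
      monomial (d + Finsupp.single 0 (d (Fin.last _))) 1 := by
    intro d
    have h1 : monomial (d + Finsupp.single 0 (d (Fin.last _))) (1 : K) =
        monomial d 1 * X 0 ^ d (Fin.last _) := by
      rw [X_pow_eq, monomial_mul_monomial, one_mul]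
    rw [h1, monomial_one_eq, Finsupp.prod_fintype _ _ (by simp),
      Finsupp.prod_fintype d _ (by simp), Fin.prod_univ_castSucc,
      Fin.prod_univ_castSucc (fun i => X i ^ d i)]
    simp only [(Fin.castSucc_lt_last _).ne, if_false, if_true, mul_pow]
    ring
  simp only [key, coeff_monomial, smul_eq_mul]
  rw [finsum_eq_single _ m]
  · simp
  · intro d hd
    rw [if_neg, mul_zero]
    intro h
    apply hd
    have hl : d (Fin.last _) = m (Fin.last _) := by
      have := DFunLike.congr_fun h (Fin.last _)
      simpa [Finsupp.single_apply, (Fin.last_pos (n := n + 1)).ne] using this.symm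
    rw [hl] at h
    exact (add_right_cancel h).symm

lemma coeff_inSecond (γ : MvPowerSeries (Fin 1) K) (m : Fin 2 →₀ ℕ) :
    coeff m (inSecond γ) = if m 0 = 0 then coeff (Finsupp.single 0 (m 1)) γ else 0 := by
  have hm : ∀ x : Fin 1 →₀ ℕ, Finsupp.mapDomain (fun _ : Fin 1 => (1 : Fin 2)) x =
      Finsupp.single 1 (x 0) := by
    intro x
    have : x = Finsupp.single 0 (x 0) := by ext; simp
    rw [this, Finsupp.mapDomain_single]; simp
  rw [inSecond]
  split_ifs with h
  · let e : Fin 1 ↪ Fin 2 := ⟨fun _ => 1, fun _ _ _ => Subsingleton.elim _ _⟩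
    have := coeff_embDomain_rename (R := K) e γ (Finsupp.single 0 (m 1))
    rw [Finsupp.embDomain_eq_mapDomain] at this
    have hm' : Finsupp.mapDomain e (Finsupp.single 0 (m 1)) = m := by
      change Finsupp.mapDomain (fun _ => 1) _ = m
      rw [hm]
      ext i; fin_cases i <;> simp [h]
    rw [← this, hm']; rfl
  · apply coeff_rename_eq_zero
    rintro ⟨x, rfl⟩
    rw [hm] at h
    simp at h

end Coefficients

/-! ### Weierstrass division -/

section Division

variable {K : Type*} [Field K] {n : ℕ}

/-- The weight `(|m'|, mₙ)` of an exponent, in the lexicographic order. -/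
noncomputable def lexWeight (m : Fin (n + 1) →₀ ℕ) : ℕ ×ₗ ℕ :=
  toLex ((initExp m).degree, m (Fin.last n))

/-- `F(0, xₙ)` has order `d` and leading coefficient `c`. -/
def RegularInLast (d : ℕ) (c : K) (F : MvPowerSeries (Fin (n + 1)) K) : Prop :=
  c ≠ 0 ∧ (∀ j < d, coeff (Finsupp.single (Fin.last n) j) F = 0) ∧
    coeff (Finsupp.single (Fin.last n) d) F = c

lemma regularInLast_of_restrictLast {d : ℕ} {F : MvPowerSeries (Fin (n + 1)) K}
    {u : PowerSeries K} (hu : PowerSeries.constantCoeff u ≠ 0)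
    (h : restrictLast F = PowerSeries.X ^ d * u) :
    RegularInLast d (PowerSeries.constantCoeff u) F := by
  have key : ∀ j, coeff (Finsupp.single (Fin.last n) j) F =
      PowerSeries.coeff j (PowerSeries.X ^ d * u) := by
    intro j; rw [← h, restrictLast, PowerSeries.coeff_mk]
  refine ⟨hu, fun j hj => ?_, ?_⟩
  · rw [key, PowerSeries.coeff_X_pow_mul', if_neg (not_le.2 hj)]
  · rw [key, PowerSeries.coeff_X_pow_mul']; simp

-- In a pair of exponents with the given sum, if the first one involves `x'`, the second has smaller
-- degree in `x'`. Otherwise the coefficient of `F` vanishes below `xₙ ^ d`, equals `c` at `xₙ ^ d`,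
-- and beyond it the second exponent has a smaller last entry. So the product is triangular in the
-- coefficients of `Q`, with diagonal entry `c`.
open Classical in
lemma coeff_mul_of_regularInLast {d : ℕ} {c : K} {F : MvPowerSeries (Fin (n + 1)) K}
    (hF : RegularInLast d c F) (Q : MvPowerSeries (Fin (n + 1)) K) (m : Fin (n + 1) →₀ ℕ) :
    coeff (m + Finsupp.single (Fin.last n) d) (F * Q) = c * coeff m Q +
      ∑ p ∈ Finset.HasAntidiagonal.antidiagonal (m + Finsupp.single (Fin.last n) d),
        if lexWeight p.2 < lexWeight m then coeff p.1 F * coeff p.2 Q else 0 := by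
  have hc : c * coeff m Q = ∑ p ∈ Finset.HasAntidiagonal.antidiagonal (m + Finsupp.single (Fin.last n) d),
      if p = (Finsupp.single (Fin.last n) d, m) then c * coeff m Q else 0 := by
    rw [Finset.sum_ite_eq', if_pos]
    simp [add_comm]
  rw [coeff_mul, hc, ← Finset.sum_add_distrib]
  refine Finset.sum_congr rfl fun p hp => ?_
  rw [Finset.HasAntidiagonal.mem_antidiagonal] at hp
  split_ifs with h1 h2 h2
  · subst h1; exact absurd h2 (lt_irrefl _)
  · subst h1; rw [hF.2.2, add_zero]
  · rw [zero_add]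
  · rw [add_zero]
    have hi := congrArg initExp hp
    have hl := DFunLike.congr_fun hp (Fin.last n)
    simp only [initExp_add, initExp_single_last, add_zero, Finsupp.add_apply,
      Finsupp.single_eq_same] at hi hl
    have hdeg := congrArg Finsupp.degree hi
    rw [map_add] at hdeg
    simp only [lexWeight, Prod.Lex.toLex_lt_toLex, not_or, not_and, not_lt] at h2
    have h0 : initExp p.1 = 0 := by
      rw [← Finsupp.degree_eq_zero_iff]; omega
    have h3 := h2.2 (by rw [← hdeg, h0]; simp)
    rw [h0, zero_add] at hi
    have hp1 : p.1 = Finsupp.single (Fin.last n) (p.1 (Fin.last n)) :=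
      exp_ext (by simp [h0]) (by simp)
    rcases lt_or_ge (p.1 (Fin.last n)) d with h4 | h4
    · rw [hp1, hF.2.1 _ h4, zero_mul]
    · exfalso
      have h5 : p.1 (Fin.last n) = d := by omega
      refine h1 (Prod.ext (by rw [hp1, h5]) (exp_ext hi (by dsimp only; omega)))

lemma wellFounded_lexWeight :
    WellFounded fun a b : Fin (n + 1) →₀ ℕ => lexWeight a < lexWeight b :=
  InvImage.wf lexWeight wellFounded_lt

/-- The remainder does not reach the exponents `m + d eₙ`, so there the equation is a homogeneous
triangular system for `Q`. -/
lemma eq_zero_of_mul_add_polyInLast_eq_zero {d : ℕ} {c : K} {F : MvPowerSeries (Fin (n + 1)) K}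
    (hF : RegularInLast d c F) {Q : MvPowerSeries (Fin (n + 1)) K}
    {R : Polynomial (MvPowerSeries (Fin n) K)} (hR : R.degree < d)
    (h : F * Q + polyInLast K n R = 0) : Q = 0 ∧ R = 0 := by
  classical
  have hQ : Q = 0 := by
    ext m
    induction m using wellFounded_lexWeight.induction with
    | _ m ih =>
      have h1 := congrArg (coeff (m + Finsupp.single (Fin.last n) d)) h
      rw [map_add, coeff_mul_of_regularInLast hF, coeff_polyInLast,
        Polynomial.coeff_eq_zero_of_degree_lt, map_zero, map_zero, add_zero,
        Finset.sum_eq_zero, add_zero] at h1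
      · simpa [hF.1] using h1
      · intro p _
        split_ifs with hp
        · rw [ih _ hp]; simp
        · rfl
      · exact hR.trans_le (Nat.cast_le.2 (by simp))
  subst hQ
  refine ⟨rfl, ?_⟩
  ext i m
  have h1 := congrArg (coeff (snocExp m i)) h
  simpa [coeff_polyInLast] using h1

theorem weierstrass_division_unique {d : ℕ} {c : K} {F : MvPowerSeries (Fin (n + 1)) K}
    (hF : RegularInLast d c F) {Q Q' : MvPowerSeries (Fin (n + 1)) K}
    {R R' : Polynomial (MvPowerSeries (Fin n) K)} (hR : R.degree < d) (hR' : R'.degree < d)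
    (h : F * Q + polyInLast K n R = F * Q' + polyInLast K n R') : Q' = Q ∧ R' = R := by
  have := eq_zero_of_mul_add_polyInLast_eq_zero hF (Q := Q' - Q) (R := R' - R)
    ((Polynomial.degree_sub_le _ _).trans_lt (max_lt hR' hR))
    (by rw [map_sub, mul_sub]; linear_combination -h)
  exact ⟨sub_eq_zero.1 this.1, sub_eq_zero.1 this.2⟩

/-- The triangular system determines `Q` by recursion on the weight, and `R` is what remains of `G -
F * Q`. Only `c` is ever inverted, so one and the same pair has its coefficients in every admissible
subring `S`. -/
theorem weierstrass_division_exists {d : ℕ} {c : K} {F : MvPowerSeries (Fin (n + 1)) K}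
    (hF : RegularInLast d c F) (G : MvPowerSeries (Fin (n + 1)) K) :
    ∃ (Q : MvPowerSeries (Fin (n + 1)) K) (R : Polynomial (MvPowerSeries (Fin n) K)),
      R.degree < d ∧ G = F * Q + polyInLast K n R ∧
      ∀ S : Subring K, (∀ m, coeff m F ∈ S) → (∀ m, coeff m G ∈ S) → c⁻¹ ∈ S →
        (∀ m, coeff m Q ∈ S) ∧ ∀ i m, coeff m (R.coeff i) ∈ S := by
  classical
  obtain ⟨Q, hQ⟩ : ∃ Q : MvPowerSeries (Fin (n + 1)) K, ∀ m, coeff m Q =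
      c⁻¹ * (coeff (m + Finsupp.single (Fin.last n) d) G -
        ∑ p ∈ Finset.HasAntidiagonal.antidiagonal (m + Finsupp.single (Fin.last n) d),
          if lexWeight p.2 < lexWeight m then coeff p.1 F * coeff p.2 Q else 0) := by
    refine ⟨wellFounded_lexWeight.fix fun m ih =>
      c⁻¹ * (coeff (m + Finsupp.single (Fin.last n) d) G -
        ∑ p ∈ Finset.HasAntidiagonal.antidiagonal (m + Finsupp.single (Fin.last n) d),
          if h : lexWeight p.2 < lexWeight m then coeff p.1 F * ih p.2 h else 0), fun m => ?_⟩
    exact (wellFounded_lexWeight.fix_eq _ m).trans rfl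
  -- The recursion for `Q` says precisely that `G - F * Q` has no term with last exponent at least
  -- `d`.
  have hG : ∀ m : Fin (n + 1) →₀ ℕ, d ≤ m (Fin.last n) → coeff m (G - F * Q) = 0 := by
    intro m hm
    obtain ⟨m, rfl⟩ : ∃ m', m = m' + Finsupp.single (Fin.last n) d :=
      ⟨m - Finsupp.single (Fin.last n) d, by
        rw [tsub_add_cancel_of_le]; simpa using hm⟩
    rw [map_sub, coeff_mul_of_regularInLast hF, hQ m, mul_inv_cancel_left₀ hF.1]
    ring
  let r : ℕ → MvPowerSeries (Fin n) K := fun i m => coeff (snocExp m i) (G - F * Q)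
  have hr : ∀ i m, coeff m (r i) = coeff (snocExp m i) (G - F * Q) := fun i m => rfl
  have hco : ∀ i, (∑ i ∈ Finset.range d, Polynomial.monomial i (r i)).coeff i = r i := by
    intro i
    simp only [Polynomial.finsetSum_coeff, Polynomial.coeff_monomial, Finset.sum_ite_eq',
      Finset.mem_range]
    split_ifs with h
    · rfl
    · ext m
      rw [hr, hG _ (by simpa using h), map_zero]
  refine ⟨Q, ∑ i ∈ Finset.range d, Polynomial.monomial i (r i), ?_, ?_, ?_⟩
  · rw [Polynomial.degree_lt_iff_coeff_zero]
    intro i hi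
    rw [hco]
    ext m
    rw [hr, hG _ (by simpa using hi), map_zero]
  · rw [← sub_eq_iff_eq_add']
    ext m
    rw [coeff_polyInLast, hco, hr, snocExp_initExp]
  · intro S hFS hGS hc
    have hQS : ∀ m, coeff m Q ∈ S := by
      intro m
      induction m using wellFounded_lexWeight.induction with
      | _ m ih =>
        rw [hQ]
        refine S.mul_mem hc (S.sub_mem (hGS _) (S.sum_mem fun p _ => ?_))
        split_ifs with hp
        · exact S.mul_mem (hFS _) (ih _ hp)
        · exact S.zero_mem
    refine ⟨hQS, fun i m => ?_⟩
    rw [hco, hr, map_sub, coeff_mul]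
    exact S.sub_mem (hGS _) (S.sum_mem fun p _ => S.mul_mem (hFS _) (hQS _))

end Division

/-! ### Finitely generated algebras of coefficients -/

section Coefficients

variable {O K : Type*} [CommRing O] [Field K] [Algebra O K]

/-- `O[1/f, c]`, as an `O`-subalgebra of `K`. -/
def awayAdjoin (O : Type*) {K : Type*} [CommRing O] [Field K] [Algebra O K] (f : O) (c : K) :
    Subalgebra O K := Algebra.adjoin O {(algebraMap O K f)⁻¹, c}

lemma awayAdjoin_fg (f : O) (c : K) : (awayAdjoin O f c).FG :=
  Subalgebra.fg_def.2 ⟨_, by simp, rfl⟩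

lemma inv_mem_awayAdjoin (f : O) (c : K) : (algebraMap O K f)⁻¹ ∈ awayAdjoin O f c :=
  Algebra.subset_adjoin (by simp)

lemma self_mem_awayAdjoin (f : O) (c : K) : c ∈ awayAdjoin O f c :=
  Algebra.subset_adjoin (by simp)

lemma mem_locAwayAdjoin {f : O} {c x : K} : x ∈ locAwayAdjoin O K f c ↔ x ∈ awayAdjoin O f c := by
  rw [awayAdjoin, ← Set.singleton_union, Algebra.adjoin_union_eq_adjoin_adjoin,
    Subalgebra.mem_restrictScalars]
  rfl

lemma inv_mem_of_dvd {f g : O} (hg : algebraMap O K g ≠ 0) (h : f ∣ g) (B : Subalgebra O K)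
    (hB : (algebraMap O K g)⁻¹ ∈ B) : (algebraMap O K f)⁻¹ ∈ B := by
  obtain ⟨r, rfl⟩ := h
  rw [map_mul] at hg hB
  have : (algebraMap O K f)⁻¹ =
      algebraMap O K r * (algebraMap O K f * algebraMap O K r)⁻¹ := by
    have := right_ne_zero_of_mul hg; have := left_ne_zero_of_mul hg
    field_simp
  rw [this]
  exact B.mul_mem (B.algebraMap_mem r) hB

lemma awayAdjoin_le {f : O} {c : K} {B : Subalgebra O K} (hf : (algebraMap O K f)⁻¹ ∈ B)
    (hc : c ∈ B) : awayAdjoin O f c ≤ B :=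
  Algebra.adjoin_le (by rintro x (rfl | rfl) <;> assumption)

lemma awayAdjoin_mono {f g : O} (hg : algebraMap O K g ≠ 0) (h : f ∣ g) (c : K) :
    awayAdjoin O f c ≤ awayAdjoin O g c :=
  awayAdjoin_le (inv_mem_of_dvd hg h _ (inv_mem_awayAdjoin g c)) (self_mem_awayAdjoin g c)

lemma locAway_le_iff {f : O} {B : Subalgebra O K} :
    locAway O K f ≤ B ↔ (algebraMap O K f)⁻¹ ∈ B := by
  rw [locAway, Algebra.adjoin_le_iff, Set.singleton_subset_iff]; rfl

lemma exists_pow_mul_of_mem_locAway {f : O} (hf : algebraMap O K f ≠ 0) {x : K}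
    (hx : x ∈ locAway O K f) : ∃ (N : ℕ) (y : O), algebraMap O K (f ^ N) * x = algebraMap O K y := by
  induction hx using Algebra.adjoin_induction with
  | mem x hx =>
    rw [Set.mem_singleton_iff] at hx; subst hx
    exact ⟨1, 1, by simp [hf]⟩
  | algebraMap r => exact ⟨0, r, by simp⟩
  | add x y _ _ ihx ihy =>
    obtain ⟨N, a, ha⟩ := ihx
    obtain ⟨M, b, hb⟩ := ihy
    refine ⟨N + M, f ^ M * a + f ^ N * b, ?_⟩
    rw [map_add, map_mul _ _ a, map_mul _ _ b, ← ha, ← hb, pow_add, map_mul]; ring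
  | mul x y _ _ ihx ihy =>
    obtain ⟨N, a, ha⟩ := ihx
    obtain ⟨M, b, hb⟩ := ihy
    refine ⟨N + M, a * b, ?_⟩
    rw [map_mul, ← ha, ← hb, pow_add, map_mul]; ring

lemma mem_locAway_of_pow_mul {f : O} (hf : algebraMap O K f ≠ 0) {x : K} {N : ℕ} {y : O}
    (h : algebraMap O K (f ^ N) * x = algebraMap O K y) : x ∈ locAway O K f := by
  have : x = (algebraMap O K f)⁻¹ ^ N * algebraMap O K y := by
    rw [← h, map_pow, inv_pow, inv_mul_cancel_left₀ (pow_ne_zero _ hf)]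
  rw [this]
  have hi : (algebraMap O K f)⁻¹ ∈ locAway O K f := Algebra.subset_adjoin rfl
  exact Subalgebra.mul_mem _ (Subalgebra.pow_mem _ hi _) (Subalgebra.algebraMap_mem _ y)

lemma isLocalization_locAway (hinj : Function.Injective (algebraMap O K)) {f : O} (hf : f ≠ 0) :
    IsLocalization.Away f (locAway O K f) := by
  have hf' : algebraMap O K f ≠ 0 := by rwa [map_ne_zero_iff _ hinj]
  refine ⟨?_, ?_, ?_⟩
  · rintro ⟨_, N, rfl⟩
    have hu : IsUnit (algebraMap O (locAway O K f) f) :=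
      IsUnit.of_mul_eq_one (⟨(algebraMap O K f)⁻¹, Algebra.subset_adjoin rfl⟩ : locAway O K f)
        (Subtype.ext (mul_inv_cancel₀ hf'))
    simpa only [map_pow] using hu.pow N
  · intro z
    obtain ⟨N, y, h⟩ := exists_pow_mul_of_mem_locAway hf' z.2
    refine ⟨⟨y, ⟨_, N, rfl⟩⟩, ?_⟩
    ext
    rw [mul_comm]
    exact h
  · intro x y h
    exact ⟨1, by simpa using hinj (congrArg Subtype.val h)⟩

end Coefficients

/-! ### Eisenstein series and finitely generated coefficient algebras -/

section Eisenstein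

variable {O K : Type*} [CommRing O] [Field K] [Algebra O K]

lemma algebraMap_injective_of_tower (L : Type*) [Field L] [Algebra O L] [IsFractionRing O L]
    [Algebra L K] [IsScalarTower O L K] : Function.Injective (algebraMap O K) := by
  rw [IsScalarTower.algebraMap_eq O L K]
  exact (algebraMap L K).injective.comp (IsFractionRing.injective O L)

lemma coeff_mem_of_mem_eisensteinAt {n : ℕ} {f : O} {c : K} {F : MvPowerSeries (Fin n) K}
    (hF : F ∈ eisensteinAt O K n f c) (m : Fin n →₀ ℕ) : coeff m F ∈ awayAdjoin O f c := by
  classical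
  revert m
  refine Algebra.adjoin_induction (p := fun x _ => ∀ m, coeff m x ∈ awayAdjoin O f c)
    ?_ ?_ ?_ ?_ hF
  · intro x hx m
    rw [Set.mem_singleton_iff] at hx; subst hx
    rw [coeff_C]
    split_ifs
    · exact self_mem_awayAdjoin f c
    · exact zero_mem _
  · rintro ⟨_, G, rfl⟩ m
    have : coeff m (algebraMap (seriesLocAway O K n f) (MvPowerSeries (Fin n) K)
      ⟨_, G, rfl⟩) = coeff m G := by
      change coeff m (MvPowerSeries.map (locAway O K f).val.toRingHom G) = _
      rw [coeff_map]; rfl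
    rw [this]
    exact locAway_le_iff.2 (inv_mem_awayAdjoin f c) (coeff m G).2
  · intro x y _ _ hx hy m
    rw [map_add]; exact add_mem (hx m) (hy m)
  · intro x y _ _ hx hy m
    rw [coeff_mul]
    exact sum_mem fun p _ => mul_mem (hx _) (hy _)

/-- Division by a monic equation of `c` bounds the number of powers needed. That `N` does not depend
on `x` is what allows infinitely many coefficients to be expanded simultaneously. -/
lemma exists_forall_eq_sum_of_isIntegral (f : O) {c : K} (hc : IsIntegral O c) :
    ∃ N : ℕ, ∀ x ∈ awayAdjoin O f c, ∃ a : ℕ → locAway O K f,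
      x = ∑ i ∈ Finset.range N, (a i : K) * c ^ i := by
  obtain ⟨q, hq, hqc⟩ := hc
  -- Only the weak bound on the degree of the remainder is used, hence the extra power.
  refine ⟨q.natDegree + 1, fun x hx => ?_⟩
  rw [← mem_locAwayAdjoin, locAwayAdjoin, Algebra.adjoin_singleton_eq_range_aeval] at hx
  obtain ⟨p, rfl⟩ := hx
  let q' := q.map (algebraMap O (locAway O K f))
  have hq' : q'.Monic := hq.map _
  have hqc' : Polynomial.aeval c q' = 0 := by
    rw [Polynomial.aeval_map_algebraMap]; exact hqc
  refine ⟨fun i => (p %ₘ q').coeff i, ?_⟩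
  change Polynomial.aeval c p = _
  rw [← Polynomial.aeval_modByMonic_eq_self_of_root hqc', Polynomial.aeval_eq_sum_range']
  · rfl
  · refine Nat.lt_succ_of_le ((Polynomial.natDegree_modByMonic_le _ hq').trans ?_)
    exact Polynomial.natDegree_map_le

/-- Expanding every coefficient in the same `N` powers of `c` and collecting the `i`-th components
into a series `A i` writes `F` as `∑ A i * c ^ i`. -/
lemma mem_eisensteinAt_of_isIntegral {n : ℕ} {f : O} {c : K} (hc : IsIntegral O c)
    {F : MvPowerSeries (Fin n) K} (hF : ∀ m, coeff m F ∈ awayAdjoin O f c) :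
    F ∈ eisensteinAt O K n f c := by
  obtain ⟨N, key⟩ := exists_forall_eq_sum_of_isIntegral f hc
  choose a ha using fun m => key _ (hF m)
  let A : ℕ → MvPowerSeries (Fin n) (locAway O K f) := fun i m => a m i
  have hFA : F = ∑ i ∈ Finset.range N,
      MvPowerSeries.map (σ := Fin n) (locAway O K f).val.toRingHom (A i) * C c ^ i := by
    ext m
    rw [ha, map_sum]
    refine Finset.sum_congr rfl fun i _ => ?_
    rw [← map_pow, coeff_mul_C, coeff_map]
    rfl
  rw [hFA]
  have hC : (C c : MvPowerSeries (Fin n) K) ∈ eisensteinAt O K n f c := Algebra.subset_adjoin rfl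
  refine Subalgebra.sum_mem _ fun i _ => Subalgebra.mul_mem _ ?_ (Subalgebra.pow_mem _ hC _)
  exact Subalgebra.algebraMap_mem (eisensteinAt O K n f c)
    (⟨_, A i, rfl⟩ : seriesLocAway O K n f)

variable [IsDomain O] (L : Type*) [Field L] [Algebra O L] [IsFractionRing O L] [Algebra L K]
  [IsScalarTower O L K]

lemma exists_mul_mem_adjoin {c t : K} (ht : t ∈ Algebra.adjoin L {c}) :
    ∃ g : O, g ≠ 0 ∧ algebraMap O K g * t ∈ Algebra.adjoin O {c} := by
  induction ht using Algebra.adjoin_induction with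
  | mem x hx => exact ⟨1, one_ne_zero, by simpa using Algebra.subset_adjoin hx⟩
  | algebraMap r =>
    obtain ⟨a, b, hb, rfl⟩ := IsFractionRing.div_surjective (A := O) r
    have hb' : algebraMap O K b ≠ 0 := by
      rw [map_ne_zero_iff _ (algebraMap_injective_of_tower L)]
      exact nonZeroDivisors.ne_zero hb
    refine ⟨b, nonZeroDivisors.ne_zero hb, ?_⟩
    rw [map_div₀, ← IsScalarTower.algebraMap_apply, ← IsScalarTower.algebraMap_apply,
      mul_div_cancel₀ _ hb']
    exact Subalgebra.algebraMap_mem _ _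
  | add x y _ _ ihx ihy =>
    obtain ⟨a, ha, ha'⟩ := ihx
    obtain ⟨b, hb, hb'⟩ := ihy
    refine ⟨a * b, mul_ne_zero ha hb, ?_⟩
    have : algebraMap O K (a * b) * (x + y) = algebraMap O K b * (algebraMap O K a * x) +
      algebraMap O K a * (algebraMap O K b * y) := by rw [map_mul]; ring
    rw [this]
    exact add_mem (mul_mem (Subalgebra.algebraMap_mem _ _) ha')
      (mul_mem (Subalgebra.algebraMap_mem _ _) hb')
  | mul x y _ _ ihx ihy =>
    obtain ⟨a, ha, ha'⟩ := ihx
    obtain ⟨b, hb, hb'⟩ := ihy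
    refine ⟨a * b, mul_ne_zero ha hb, ?_⟩
    have : algebraMap O K (a * b) * (x * y) = (algebraMap O K a * x) *
      (algebraMap O K b * y) := by rw [map_mul]; ring
    rw [this]
    exact mul_mem ha' hb'

lemma exists_mem_awayAdjoin {c t : K} (ht : t ∈ Algebra.adjoin L {c}) :
    ∃ g : O, g ≠ 0 ∧ t ∈ awayAdjoin O g c := by
  obtain ⟨g, hg, h⟩ := exists_mul_mem_adjoin (O := O) L ht
  refine ⟨g, hg, ?_⟩
  have hg' : algebraMap O K g ≠ 0 := by
    rwa [map_ne_zero_iff _ (algebraMap_injective_of_tower L)]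
  rw [← inv_mul_cancel_left₀ hg' t]
  exact mul_mem (inv_mem_awayAdjoin g c)
    (Algebra.adjoin_mono (s := {c}) (by simp) h)

include L in
/-- A finitely generated `O`-subalgebra of `K` is contained in some `O[1/f, c]`, where `c` is
integral over `O`. -/
theorem exists_le_awayAdjoin [CharZero L] [Algebra.IsAlgebraic L K] {B : Subalgebra O K} (hB : B.FG) :
    ∃ (f : O) (c : K), f ≠ 0 ∧ IsIntegral O c ∧ B ≤ awayAdjoin O f c := by
  classical
  obtain ⟨T, rfl⟩ := hB
  have hinj : Function.Injective (algebraMap O K) := algebraMap_injective_of_tower L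
  have : FiniteDimensional L (IntermediateField.adjoin L (T : Set K)) :=
    IntermediateField.finiteDimensional_adjoin fun x _ => Algebra.IsIntegral.isIntegral x
  -- A primitive element of `L(T)`, multiplied by a nonzero element of `O`, becomes integral over
  -- `O` and still generates the same field.
  obtain ⟨⟨α, hα⟩, hα'⟩ := Field.exists_primitive_element L (IntermediateField.adjoin L (T : Set K))
  obtain ⟨y, hy, hyα⟩ := ((IsFractionRing.isAlgebraic_iff O L K).2
    (Algebra.IsAlgebraic.isAlgebraic α)).exists_integral_multiple
  have hy' : algebraMap O K y ≠ 0 := by rwa [map_ne_zero_iff _ hinj]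
  set c := y • α with hc
  have hT : ∀ t ∈ T, t ∈ Algebra.adjoin L {c} := by
    intro t ht
    have h1 : t ∈ IntermediateField.adjoin L {α} := by
      have h2 : (⟨t, IntermediateField.subset_adjoin L _ ht⟩ :
          IntermediateField.adjoin L (T : Set K)) ∈ IntermediateField.adjoin L {⟨α, hα⟩} := by
        rw [hα']; trivial
      have h3 := IntermediateField.mem_lift (F := IntermediateField.adjoin L (T : Set K))
        ⟨t, IntermediateField.subset_adjoin L _ ht⟩ |>.2 h2
      rwa [IntermediateField.lift_adjoin_simple] at h3
    have h4 : IntermediateField.adjoin L {α} ≤ IntermediateField.adjoin L {c} := by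
      rw [IntermediateField.adjoin_simple_le_iff]
      have : α = (algebraMap L K (algebraMap O L y))⁻¹ * c := by
        rw [hc, Algebra.smul_def, ← IsScalarTower.algebraMap_apply, inv_mul_cancel_left₀ hy']
      rw [this, ← map_inv₀]
      exact mul_mem (IntermediateField.algebraMap_mem _ _) (IntermediateField.mem_adjoin_simple_self _ _)
    have h5 := h4 h1
    rwa [← IntermediateField.mem_toSubalgebra,
      IntermediateField.adjoin_simple_toSubalgebra_of_isAlgebraic
        (Algebra.IsAlgebraic.isAlgebraic c)] at h5
  choose! g hg hg' using fun t ht => exists_mem_awayAdjoin (O := O) L (hT t ht)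
  have hne : ∏ t ∈ T, g t ≠ 0 := Finset.prod_ne_zero_iff.2 hg
  refine ⟨∏ t ∈ T, g t, c, hne, hyα, Algebra.adjoin_le fun t ht => ?_⟩
  exact awayAdjoin_mono (by rwa [map_ne_zero_iff _ hinj]) (Finset.dvd_prod_of_mem g ht) c (hg' t ht)

/-- The elements integral over `O_f` of a finite extension of `L` lie in a finitely generated
`O`-subalgebra. -/
theorem exists_fg_of_isIntegral_locAway [CharZero L] [IsIntegrallyClosed O] {f : O} (hf : f ≠ 0)
    (E : IntermediateField L K) [FiniteDimensional L E] :
    ∃ B : Subalgebra O K, B.FG ∧ ∀ x ∈ E, IsIntegral (locAway O K f) x → x ∈ B := by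
  classical
  have hinj : Function.Injective (algebraMap O K) := algebraMap_injective_of_tower L
  have hf' : algebraMap O K f ≠ 0 := by rwa [map_ne_zero_iff _ hinj]
  have := isLocalization_locAway hinj hf
  have : IsScalarTower O E K := IsScalarTower.of_algebraMap_eq fun _ => by
    rw [IsScalarTower.algebraMap_apply O L K, IsScalarTower.algebraMap_apply O L E]; rfl
  -- For a basis of integral elements, the trace-dual basis spans over `O` a module containing the
  -- integral closure of `O` in `E`. An element integral over `O_f` enters that closure after
  -- multiplication by a power of `f`.
  obtain ⟨s, b, hb⟩ := FiniteDimensional.exists_is_basis_integral O L E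
  let b' := (Algebra.traceForm L E).dualBasis (traceForm_nondegenerate L E) b
  refine ⟨Algebra.adjoin O ({(algebraMap O K f)⁻¹} ∪ Set.range fun i => (b' i : K)),
    Subalgebra.fg_def.2 ⟨_, (Set.finite_singleton _).union (Set.finite_range _), rfl⟩, ?_⟩
  intro x hxE hx
  obtain ⟨⟨_, N, rfl⟩, hm⟩ :=
    IsIntegral.exists_multiple_integral_of_isLocalization (Submonoid.powers f) x hx
  have hm' : IsIntegral O (f ^ N • x) := hm
  have hE : f ^ N • (⟨x, hxE⟩ : E) ∈ integralClosure O E := by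
    rw [mem_integralClosure_iff]
    rwa [← isIntegral_algebraMap_iff (B := K) (algebraMap E K).injective]
  have h2 := integralClosure_le_span_dualBasis b hb
    (show _ ∈ Subalgebra.toSubmodule (integralClosure O E) from hE)
  have h3 : ∀ z : E, z ∈ Submodule.span O (Set.range b') → (z : K) ∈
      Algebra.adjoin O ({(algebraMap O K f)⁻¹} ∪ Set.range fun i => (b' i : K)) := by
    intro z hz
    induction hz using Submodule.span_induction with
    | mem z hz =>
      obtain ⟨i, rfl⟩ := hz
      exact Algebra.subset_adjoin (Or.inr ⟨i, rfl⟩)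
    | zero => exact zero_mem _
    | add x y _ _ hx hy => exact add_mem hx hy
    | smul a x _ hx => exact Subalgebra.smul_mem _ hx a
  have h4 := h3 _ h2
  have : x = (algebraMap O K f)⁻¹ ^ N * (f ^ N • x) := by
    rw [Algebra.smul_def, map_pow, inv_pow, inv_mul_cancel_left₀ (pow_ne_zero _ hf')]
  rw [this]
  exact Subalgebra.mul_mem _ (Subalgebra.pow_mem _
    (Algebra.subset_adjoin (Set.mem_union_left _ (Set.mem_singleton _))) _) h4

include L in
/-- The Eisenstein series are the series with coefficients in a finitely generated
`O`-subalgebra of `K`. -/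
theorem mem_eisensteinSeries_iff [CharZero L] [Algebra.IsAlgebraic L K] {n : ℕ} {F : MvPowerSeries (Fin n) K} :
    F ∈ eisensteinSeries O K n ↔ ∃ B : Subalgebra O K, B.FG ∧ ∀ m, coeff m F ∈ B := by
  constructor
  · rintro ⟨c, f, -, hF⟩
    exact ⟨_, awayAdjoin_fg f c, coeff_mem_of_mem_eisensteinAt hF⟩
  · rintro ⟨B, hB, hF⟩
    obtain ⟨f, c, hf, hc, hle⟩ := exists_le_awayAdjoin L hB
    exact ⟨c, f, hf, mem_eisensteinAt_of_isIntegral hc fun m => hle (hF m)⟩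

end Eisenstein

/-! ### The Eisenstein series form a Weierstrass family -/

section WeierstrassFamily

variable {O K : Type*} [CommRing O] [Field K] [Algebra O K]

lemma Subalgebra.exists_fg_insert {B : Subalgebra O K} (hB : B.FG) (x : K) :
    ∃ B' : Subalgebra O K, B'.FG ∧ B ≤ B' ∧ x ∈ B' :=
  ⟨B ⊔ Algebra.adjoin O {x}, hB.sup (Subalgebra.fg_def.2 ⟨{x}, Set.finite_singleton x, rfl⟩),
    le_sup_left, le_sup_right (a := B) (Algebra.subset_adjoin rfl)⟩

lemma coeff_mul_mem {n : ℕ} {B : Subalgebra O K} {F G : MvPowerSeries (Fin n) K}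
    (hF : ∀ m, coeff m F ∈ B) (hG : ∀ m, coeff m G ∈ B) (m : Fin n →₀ ℕ) :
    coeff m (F * G) ∈ B := by
  classical
  rw [coeff_mul]
  exact B.sum_mem fun p _ => B.mul_mem (hF _) (hG _)

lemma coeff_C_mem {n : ℕ} {B : Subalgebra O K} {a : K} (ha : a ∈ B) (m : Fin n →₀ ℕ) :
    coeff m (C a : MvPowerSeries (Fin n) K) ∈ B := by
  classical
  rw [coeff_C]
  split_ifs
  · exact ha
  · exact B.zero_mem

lemma coeff_rename_mem {n l : ℕ} (g : Fin n → Fin l) {B : Subalgebra O K}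
    {F : MvPowerSeries (Fin n) K} (hF : ∀ m, coeff m F ∈ B) (m : Fin l →₀ ℕ) :
    coeff m (rename g F) ∈ B := by
  rw [coeff_rename]
  exact B.sum_mem fun _ _ => hF _

lemma exists_mul_eq_one_of_constantCoeff {n : ℕ} {B : Subalgebra O K}
    {F : MvPowerSeries (Fin n) K} (hF : ∀ m, coeff m F ∈ B) (h0 : constantCoeff F ≠ 0)
    (hinv : (constantCoeff F)⁻¹ ∈ B) :
    ∃ G : MvPowerSeries (Fin n) K, (∀ m, coeff m G ∈ B) ∧ F * G = 1 := by
  let F' : MvPowerSeries (Fin n) B := fun m => ⟨coeff m F, hF m⟩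
  have hF' : MvPowerSeries.map (σ := Fin n) B.val.toRingHom F' = F := by
    ext m; rw [coeff_map]; rfl
  have hu : IsUnit F' := by
    rw [isUnit_iff_constantCoeff]
    refine IsUnit.of_mul_eq_one (⟨(constantCoeff F)⁻¹, hinv⟩ : B) (Subtype.ext ?_)
    exact mul_inv_cancel₀ h0
  obtain ⟨G', hG'⟩ := hu.exists_right_inv
  refine ⟨MvPowerSeries.map (σ := Fin n) B.val.toRingHom G', fun m => ?_, ?_⟩
  · rw [coeff_map]; exact (coeff m G').2
  · rw [← hF', ← map_mul, hG', map_one]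

variable [IsDomain O] (L : Type*) [Field L] [Algebra O L] [IsFractionRing O L]
  [Algebra L K] [Algebra.IsAlgebraic L K] [IsScalarTower O L K]

include L in
/-- Some nonzero multiple `g` of `f` makes a given element of `O_f[c]` invertible (if it is nonzero). -/
theorem exists_inv_mem_awayAdjoin {f : O} (hf : f ≠ 0) {c x : K}
    (hx : x ∈ awayAdjoin O f c) :
    ∃ g : O, g ≠ 0 ∧ f ∣ g ∧ x⁻¹ ∈ awayAdjoin O g c := by
  have hinj : Function.Injective (algebraMap O K) := algebraMap_injective_of_tower L
  have h1 : x ∈ Algebra.adjoin L {c} := by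
    have : awayAdjoin O f c ≤ (Algebra.adjoin L {c}).restrictScalars O := by
      have hc : c ∈ Algebra.adjoin L {c} := Algebra.subset_adjoin (Set.mem_singleton c)
      refine awayAdjoin_le ?_ hc
      rw [Subalgebra.mem_restrictScalars, IsScalarTower.algebraMap_apply O L K, ← map_inv₀]
      exact Subalgebra.algebraMap_mem _ _
    exact this hx
  -- As `x` is algebraic over `L`, the ring `L[c]` contains its inverse; only denominators from `O`
  -- then remain to be cleared.
  have h2 : x⁻¹ ∈ Algebra.adjoin L {c} :=
    Subalgebra.inv_mem_of_algebraic _ (x := ⟨x, h1⟩) (Algebra.IsAlgebraic.isAlgebraic _)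
  obtain ⟨g, hg, hg'⟩ := exists_mem_awayAdjoin (O := O) L h2
  refine ⟨f * g, mul_ne_zero hf hg, dvd_mul_right _ _, ?_⟩
  refine awayAdjoin_mono ?_ (dvd_mul_left g f) c hg'
  rw [map_ne_zero_iff _ hinj]
  exact mul_ne_zero hf hg

include L in
/-- Weierstrass division with control of the coefficients. -/
theorem eisenstein_division (n d : ℕ) (c : K) (f : O) (hf : f ≠ 0)
    (F : MvPowerSeries (Fin (n + 1)) K) (hF : F ∈ eisensteinAt O K (n + 1) f c)
    (u : PowerSeries K) (hu : PowerSeries.constantCoeff u ≠ 0)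
    (hFu : restrictLast F = PowerSeries.X ^ d * u) :
    (∃ g : O, g ≠ 0 ∧ f ∣ g ∧
      ∃ v ∈ locAwayAdjoin O K g c, PowerSeries.constantCoeff u * v = 1) ∧
    (∀ g : O, g ≠ 0 → f ∣ g →
      (∃ v ∈ locAwayAdjoin O K g c, PowerSeries.constantCoeff u * v = 1) →
      ∀ G ∈ eisensteinAt O K (n + 1) g c,
        ∃ (Q : MvPowerSeries (Fin (n + 1)) K) (R : Polynomial (MvPowerSeries (Fin n) K)),
          (∀ m, MvPowerSeries.coeff m Q ∈ locAwayAdjoin O K g c) ∧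
          (∀ i m, MvPowerSeries.coeff m (R.coeff i) ∈ locAwayAdjoin O K g c) ∧
          R.degree < d ∧ G = F * Q + polyInLast K n R ∧
          ∀ (Q' : MvPowerSeries (Fin (n + 1)) K) (R' : Polynomial (MvPowerSeries (Fin n) K)),
            R'.degree < d → G = F * Q' + polyInLast K n R' → Q' = Q ∧ R' = R) := by
  have hinj : Function.Injective (algebraMap O K) := algebraMap_injective_of_tower L
  have hreg := regularInLast_of_restrictLast hu hFu
  have hFc := coeff_mem_of_mem_eisensteinAt hF
  simp only [mem_locAwayAdjoin]
  constructor
  · obtain ⟨g, hg, hfg, h⟩ := exists_inv_mem_awayAdjoin L hf (hreg.2.2 ▸ hFc _)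
    exact ⟨g, hg, hfg, _, h, mul_inv_cancel₀ hu⟩
  · rintro g hg hfg ⟨v, hv, huv⟩ G hG
    have hle := awayAdjoin_mono (by rwa [map_ne_zero_iff _ hinj]) hfg c
    obtain ⟨Q, R, hR, h, hS⟩ := weierstrass_division_exists hreg G
    obtain ⟨hQS, hRS⟩ := hS (awayAdjoin O g c).toSubring (fun m => hle (hFc m))
      (coeff_mem_of_mem_eisensteinAt hG) (by rwa [inv_eq_of_mul_eq_one_right huv])
    exact ⟨Q, R, hQS, hRS, hR, h, fun Q' R' hR' h' =>
      weierstrass_division_unique hreg hR hR' (h.symm.trans h')⟩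

variable [CharZero L]

include L in
lemma exists_subalgebra_eq_eisensteinSeries (n : ℕ) :
    ∃ S : Subalgebra K (MvPowerSeries (Fin n) K), (S : Set _) = eisensteinSeries O K n := by
  refine ⟨{ carrier := eisensteinSeries O K n, mul_mem' := ?_, add_mem' := ?_,
            algebraMap_mem' := ?_ }, rfl⟩
  · intro F G hF hG
    rw [mem_eisensteinSeries_iff L] at hF hG ⊢
    obtain ⟨B, hB, hF⟩ := hF
    obtain ⟨B', hB', hG⟩ := hG
    exact ⟨B ⊔ B', hB.sup hB', coeff_mul_mem (fun m => le_sup_left (a := B) (hF m))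
      (fun m => le_sup_right (a := B) (hG m))⟩
  · intro F G hF hG
    rw [mem_eisensteinSeries_iff L] at hF hG ⊢
    obtain ⟨B, hB, hF⟩ := hF
    obtain ⟨B', hB', hG⟩ := hG
    refine ⟨B ⊔ B', hB.sup hB', fun m => ?_⟩
    rw [map_add]
    exact add_mem (le_sup_left (a := B) (hF m)) (le_sup_right (a := B) (hG m))
  · intro a
    rw [mem_eisensteinSeries_iff L]
    exact ⟨Algebra.adjoin O {a}, Subalgebra.fg_def.2 ⟨{a}, Set.finite_singleton a, rfl⟩,
      coeff_C_mem (Algebra.subset_adjoin rfl)⟩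

include L in
lemma X_mem_eisensteinSeries {n : ℕ} (i : Fin n) :
    (X i : MvPowerSeries (Fin n) K) ∈ eisensteinSeries O K n := by
  classical
  rw [mem_eisensteinSeries_iff L]
  refine ⟨⊥, Subalgebra.fg_bot, fun m => ?_⟩
  rw [coeff_X]
  split_ifs
  · exact one_mem _
  · exact zero_mem _

-- Each axiom asks that the coefficients of a new series lie in a finitely generated algebra. The
-- old algebras suffice, with one inverse adjoined for units and for division.
include L in
theorem isWeierstrassFamily_eisensteinSeries :
    IsWeierstrassFamily K (eisensteinSeries O K) where
  charZero := charZero_of_injective_algebraMap (algebraMap L K).injective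
  isSubalgebra := exists_subalgebra_eq_eisensteinSeries L
  polynomial_mem n p := by
    obtain ⟨S, hS⟩ := exists_subalgebra_eq_eisensteinSeries (O := O) (K := K) L n
    rw [← hS]
    induction p using MvPolynomial.induction_on with
    | C a => rw [MvPolynomial.coe_C]; exact S.algebraMap_mem a
    | add p q hp hq => rw [MvPolynomial.coe_add]; exact S.add_mem hp hq
    | mul_X p i hp =>
      rw [MvPolynomial.coe_mul, MvPolynomial.coe_X]
      refine S.mul_mem hp ?_
      have := X_mem_eisensteinSeries (O := O) (K := K) L i
      rwa [← hS] at this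
  inter_eq n m f := by
    rw [mem_eisensteinSeries_iff L, mem_eisensteinSeries_iff L]
    constructor
    · rintro ⟨B, hB, h⟩
      refine ⟨B, hB, fun x => ?_⟩
      rw [← coeff_embDomain_rename (Fin.castAddEmb m) f x]
      exact h _
    · rintro ⟨B, hB, h⟩
      exact ⟨B, hB, coeff_rename_mem _ h⟩
  perm_mem n σ f hf := by
    rw [mem_eisensteinSeries_iff L] at hf ⊢
    obtain ⟨B, hB, h⟩ := hf
    exact ⟨B, hB, coeff_rename_mem _ h⟩
  unit n f hf h0 := by
    rw [mem_eisensteinSeries_iff L] at hf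
    obtain ⟨B, hB, h⟩ := hf
    obtain ⟨B', hB', hle, hinv⟩ := Subalgebra.exists_fg_insert hB (constantCoeff f)⁻¹
    obtain ⟨g, hg, hfg⟩ := exists_mul_eq_one_of_constantCoeff (fun m => hle (h m)) h0 hinv
    exact ⟨g, (mem_eisensteinSeries_iff L).2 ⟨B', hB', hg⟩, hfg⟩
  division n d F hF := by
    rintro ⟨u, hu, hFu⟩ G hG
    have hreg := regularInLast_of_restrictLast hu hFu
    rw [mem_eisensteinSeries_iff L] at hF hG
    obtain ⟨B₁, hB₁, hF⟩ := hF
    obtain ⟨B₂, hB₂, hG⟩ := hG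
    obtain ⟨B, hB, hle, hinv⟩ := Subalgebra.exists_fg_insert (hB₁.sup hB₂)
      (PowerSeries.constantCoeff u)⁻¹
    obtain ⟨Q, R, hR, h, hS⟩ := weierstrass_division_exists hreg G
    obtain ⟨hQS, hRS⟩ := hS B.toSubring (fun m => hle (le_sup_left (a := B₁) (hF m)))
      (fun m => hle (le_sup_right (a := B₁) (hG m))) hinv
    refine ⟨(Q, R), ⟨(mem_eisensteinSeries_iff L).2 ⟨B, hB, hQS⟩,
      fun i => (mem_eisensteinSeries_iff L).2 ⟨B, hB, hRS i⟩, hR, h⟩, ?_⟩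
    rintro ⟨Q', R'⟩ ⟨-, -, hR', h'⟩
    obtain ⟨h1, h2⟩ := weierstrass_division_unique hreg hR hR' (h.symm.trans h')
    rw [Prod.mk.injEq]
    exact ⟨h1, h2⟩

end WeierstrassFamily

/-! ### Hyperplane sections -/

section Interpolation

/-- A linear functional on `M ⧸ W` turns the sum into a scalar polynomial in `a` with infinitely
many roots, and functionals separate the points of the quotient. -/
lemma forall_mem_of_infinite_sum_pow_smul_mem {k M : Type*} [Field k] [AddCommGroup M] [Module k M]
    (W : Submodule k M) {s : Set k} (hs : s.Infinite) (N : ℕ) (c : ℕ → M)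
    (h : ∀ a ∈ s, ∑ j ∈ Finset.range N, a ^ j • c j ∈ W) : ∀ j < N, c j ∈ W := by
  intro j hj
  rw [← Submodule.Quotient.mk_eq_zero, ← Module.forall_dual_apply_eq_zero_iff k]
  intro φ
  let p : Polynomial k :=
    ∑ i ∈ Finset.range N, Polynomial.monomial i (φ (Submodule.Quotient.mk (c i)))
  have hp : p = 0 := by
    refine Polynomial.eq_zero_of_infinite_isRoot p (hs.mono fun a ha => ?_)
    have h1 := (Submodule.Quotient.mk_eq_zero W).2 (h a ha)
    have h2 := congrArg φ h1
    rw [← Submodule.mkQ_apply, map_sum, map_sum, map_zero] at h2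
    simp only [map_smul, smul_eq_mul, Submodule.mkQ_apply] at h2
    change Polynomial.eval a p = 0
    rw [← h2]
    simp only [p, Polynomial.eval_finsetSum, Polynomial.eval_monomial, mul_comm]
  have := congrArg (fun q => Polynomial.coeff q j) hp
  simpa [p, Polynomial.finsetSum_coeff, Polynomial.coeff_monomial, hj] using this

lemma coeff_mem_of_infinite_hyperplaneSection {k O K : Type*} [Field k] [CommRing O] [Algebra k O]
    [Field K] [Algebra O K] (W : Submodule O K) {n : ℕ} {F : MvPowerSeries (Fin (n + 2)) K}
    {s : Set k} (hs : s.Infinite)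
    (h : ∀ a ∈ s, ∀ e, coeff e (hyperplaneSection (algebraMap O K (algebraMap k O a)) F) ∈ W)
    (m : Fin (n + 2) →₀ ℕ) : coeff m F ∈ W := by
  let _ : Algebra k K := ((algebraMap O K).comp (algebraMap k O)).toAlgebra
  have : IsScalarTower k O K := IsScalarTower.of_algebraMap_eq fun _ => rfl
  -- The coefficient of `F` at `m` is the coefficient of `a ^ mₙ` in the section's coefficient at
  -- `m' + mₙ e₀`.
  have key := forall_mem_of_infinite_sum_pow_smul_mem (W.restrictScalars k) hs
    ((initExp m + Finsupp.single 0 (m (Fin.last _)) : Fin (n + 1) →₀ ℕ) 0 + 1)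
    (fun j => coeff (snocExp (initExp m + Finsupp.single 0 (m (Fin.last _)) -
      Finsupp.single 0 j) j) F) (fun a ha => ?_) (m (Fin.last _)) (by simp)
  · simpa using key
  · have := h a ha (initExp m + Finsupp.single 0 (m (Fin.last _)))
    rw [coeff_hyperplaneSection] at this
    rw [Submodule.restrictScalars_mem]
    convert! this using 2
    rw [Algebra.smul_def, map_pow]; rfl

/-- The pigeonhole principle for uncountable sets; it is applied with finite sets of exponents as
indices. -/
lemma exists_not_countable_of_forall_exists {α ι : Type*} [Countable ι] {s : Set α}
    (hs : ¬ s.Countable) (R : α → ι → Prop) (h : ∀ a ∈ s, ∃ i, R a i) :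
    ∃ i, ¬ {a ∈ s | R a i}.Countable := by
  by_contra hcon
  push Not at hcon
  refine hs ((Set.countable_iUnion hcon).mono fun a ha => ?_)
  obtain ⟨i, hi⟩ := h a ha
  exact Set.mem_iUnion.2 ⟨i, ha, hi⟩

end Interpolation

/-! ### Denominators in a unique factorization domain -/

section Denominators

variable {O : Type*} [CommRing O] [UniqueFactorizationMonoid O]

lemma exists_dvd_pow_of_forall_prime_dvd {a b : O} (ha : a ≠ 0)
    (h : ∀ p, Prime p → p ∣ a → p ∣ b) : ∃ N : ℕ, a ∣ b ^ N := by
  obtain ⟨P, hP, hPa⟩ := UniqueFactorizationMonoid.exists_prime_factors a ha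
  have key : ∀ P : Multiset O, (∀ p ∈ P, p ∣ b) → P.prod ∣ b ^ P.card := by
    intro P
    induction P using Multiset.induction with
    | empty => simp
    | cons p P ih =>
      intro h
      rw [Multiset.prod_cons, Multiset.card_cons, pow_succ']
      exact mul_dvd_mul (h p (by simp)) (ih fun q hq => h q (by simp [hq]))
  refine ⟨P.card, hPa.symm.dvd.trans (key P fun p hp => h p (hP p hp) ?_)⟩
  exact (Multiset.dvd_prod hp).trans hPa.dvd

variable [IsDomain O] {L : Type*} [Field L] [Algebra O L] [IsFractionRing O L]

/-- Among the localizations `O_f`, countably many suffice to control the denominators of the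
`O`-linear combinations of a countable family. -/
lemma exists_denominators {ι : Type*} (S : ι → L) :
    ∃ q : ι → O, (∀ i, q i ≠ 0) ∧ ∀ f : O, f ≠ 0 → ∃ T : Finset ι,
      ∀ x ∈ Submodule.span O (Set.range S), x ∈ locAway O L f →
        x ∈ locAway O L (∏ i ∈ T, q i) := by
  classical
  have hinj : Function.Injective (algebraMap O L) := IsFractionRing.injective O L
  have hex : ∀ i, ∃ q : O, q ≠ 0 ∧ ∃ y, algebraMap O L q * S i = algebraMap O L y := by
    intro i
    obtain ⟨a, b, hb, h⟩ := IsFractionRing.div_surjective (A := O) (S i)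
    have hb0 := nonZeroDivisors.ne_zero hb
    refine ⟨b, hb0, a, ?_⟩
    rw [← h, mul_div_cancel₀]
    rwa [map_ne_zero_iff _ hinj]
  choose q hq hqS using hex
  refine ⟨q, hq, fun f hf => ?_⟩
  obtain ⟨P, hP, hPf⟩ := UniqueFactorizationMonoid.exists_prime_factors f hf
  -- For each prime factor of `f` that divides some `q i`, one such index is put into `T`. This
  -- choice depends on `f` only, not on `x`.
  have hT : ∀ P : Multiset O, ∃ T : Finset ι, ∀ p ∈ P, (∃ i, p ∣ q i) → ∃ i ∈ T, p ∣ q i := by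
    intro P
    induction P using Multiset.induction with
    | empty => exact ⟨∅, by simp⟩
    | cons p P ih =>
      obtain ⟨T, hT⟩ := ih
      by_cases hp : ∃ i, p ∣ q i
      · obtain ⟨i, hi⟩ := hp
        refine ⟨insert i T, fun r hr hr' => ?_⟩
        rcases Multiset.mem_cons.1 hr with rfl | hr
        · exact ⟨i, by simp, hi⟩
        · obtain ⟨j, hj, hj'⟩ := hT r hr hr'
          exact ⟨j, by simp [hj], hj'⟩
      · refine ⟨T, fun r hr hr' => ?_⟩
        rcases Multiset.mem_cons.1 hr with rfl | hr
        · exact absurd hr' hp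
        · exact hT r hr hr'
  obtain ⟨T, hT⟩ := hT P
  refine ⟨T, fun x hx hxf => ?_⟩
  have hspan : ∃ (U : Finset ι) (y : O), algebraMap O L (∏ i ∈ U, q i) * x = algebraMap O L y := by
    clear hxf
    induction hx using Submodule.span_induction with
    | mem x hx =>
      obtain ⟨i, rfl⟩ := hx
      obtain ⟨y, hy⟩ := hqS i
      exact ⟨{i}, y, by simpa using hy⟩
    | zero => exact ⟨∅, 0, by simp⟩
    | add x y _ _ ihx ihy =>
      obtain ⟨U, a, ha⟩ := ihx
      obtain ⟨V, b, hb⟩ := ihy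
      obtain ⟨r, hr⟩ := Finset.prod_dvd_prod_of_subset U (U ∪ V) q Finset.subset_union_left
      obtain ⟨r', hr'⟩ := Finset.prod_dvd_prod_of_subset V (U ∪ V) q Finset.subset_union_right
      refine ⟨U ∪ V, a * r + b * r', ?_⟩
      rw [mul_add, map_add, map_mul, map_mul, ← ha, ← hb]
      nth_rewrite 1 [hr]
      rw [hr', map_mul, map_mul]
      ring
    | smul a x _ ih =>
      obtain ⟨U, b, hb⟩ := ih
      refine ⟨U, a * b, ?_⟩
      rw [Algebra.smul_def, map_mul, ← hb]
      ring
  obtain ⟨U, y, hy⟩ := hspan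
  have hf' : algebraMap O L f ≠ 0 := by rwa [map_ne_zero_iff _ hinj]
  obtain ⟨N, z, hz⟩ := exists_pow_mul_of_mem_locAway hf' hxf
  -- The reduced denominator `b` divides both a power of `f` and a finite product of the `q i`. So
  -- each prime factor of `b` is associated to a prime factor of `f` dividing some `q i`, and
  -- therefore divides the product over `T`.
  obtain ⟨a, ⟨b, hb⟩, hab, rfl⟩ := IsFractionRing.exists_reduced_fraction (A := O) x
  have hb0 : b ≠ 0 := nonZeroDivisors.ne_zero hb
  have hb' : algebraMap O L b ≠ 0 := by rwa [map_ne_zero_iff _ hinj]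
  have hdvd : ∀ g w : O, algebraMap O L g * IsLocalization.mk' L a ⟨b, hb⟩ = algebraMap O L w →
      b ∣ g := by
    intro g w h
    rw [IsFractionRing.mk'_eq_div, mul_div_assoc', div_eq_iff hb', ← map_mul, ← map_mul] at h
    exact hab.symm.dvd_of_dvd_mul_right ⟨w, by rw [hinj h, mul_comm]⟩
  obtain ⟨M, w, hM⟩ := exists_dvd_pow_of_forall_prime_dvd (b := ∏ i ∈ T, q i) hb0 (by
    intro p hp hpb
    have hpf : p ∣ P.prod := (hp.dvd_of_dvd_pow (hpb.trans (hdvd _ _ hz))).trans hPf.symm.dvd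
    obtain ⟨p', hp'P, hpp'⟩ := hp.exists_mem_multiset_dvd hpf
    have hass : Associated p p' := hp.associated_of_dvd (hP p' hp'P) hpp'
    obtain ⟨i, -, hi⟩ := (hp.dvd_finsetProd_iff _).1 (hpb.trans (hdvd _ _ hy))
    obtain ⟨j, hj, hj'⟩ := hT p' hp'P ⟨i, hass.symm.dvd.trans hi⟩
    exact (hpp'.trans hj').trans (Finset.dvd_prod_of_mem q hj))
  refine mem_locAway_of_pow_mul (f := ∏ i ∈ T, q i) ?_ (N := M) (y := w * a) ?_
  · rw [map_ne_zero_iff _ hinj]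
    exact Finset.prod_ne_zero_iff.2 fun i _ => hq i
  · rw [hM, IsFractionRing.mk'_eq_div, map_mul, map_mul]
    field_simp

end Denominators

/-! ### Linear functionals on finitely generated coefficient algebras -/

section Functionals

variable {O K : Type*} [CommRing O] [Field K] [Algebra O K]
variable {L : Type*} [Field L] [Algebra O L] [IsFractionRing O L] [Algebra L K]
  [IsScalarTower O L K]

lemma exists_algebraMap_eq_of_mem_locAway {f : O} (hf : f ≠ 0) {x : K}
    (hx : x ∈ locAway O K f) : ∃ y ∈ locAway O L f, algebraMap L K y = x := by
  have hf' : algebraMap O K f ≠ 0 := by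
    rwa [map_ne_zero_iff _ (algebraMap_injective_of_tower L)]
  have hf'' : algebraMap O L f ≠ 0 := by
    rwa [map_ne_zero_iff _ (IsFractionRing.injective O L)]
  obtain ⟨N, y, h⟩ := exists_pow_mul_of_mem_locAway hf' hx
  refine ⟨(algebraMap O L f ^ N)⁻¹ * algebraMap O L y,
    mem_locAway_of_pow_mul hf'' (N := N) (y := y) ?_, ?_⟩
  · rw [map_pow, mul_inv_cancel_left₀ (pow_ne_zero _ hf'')]
  · rw [map_mul, map_inv₀, map_pow, ← IsScalarTower.algebraMap_apply,
      ← IsScalarTower.algebraMap_apply, ← h, map_pow, inv_mul_cancel_left₀ (pow_ne_zero _ hf')]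

variable [IsDomain O] [CharZero L] [Algebra.IsAlgebraic L K]

/-- An `L`-linear functional maps a finitely generated `O`-algebra into some `O_f`. -/
lemma exists_forall_functional_mem_locAway (φ : K →ₗ[L] L) {B : Subalgebra O K} (hB : B.FG) :
    ∃ f : O, f ≠ 0 ∧ ∀ x ∈ B, φ x ∈ locAway O L f := by
  have hinj : Function.Injective (algebraMap O L) := IsFractionRing.injective O L
  obtain ⟨f, c, hf, hc, hle⟩ := exists_le_awayAdjoin L hB
  obtain ⟨N, hN⟩ := exists_forall_eq_sum_of_isIntegral f hc
  have hex : ∀ l : L, ∃ g : O, g ≠ 0 ∧ l ∈ locAway O L g := by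
    intro l
    obtain ⟨a, b, hb, rfl⟩ := IsFractionRing.div_surjective (A := O) l
    have hb0 := nonZeroDivisors.ne_zero hb
    refine ⟨b, hb0, mem_locAway_of_pow_mul (N := 1) (y := a) ?_ ?_⟩
    · rwa [map_ne_zero_iff _ hinj]
    · rw [pow_one, mul_div_cancel₀]; rwa [map_ne_zero_iff _ hinj]
  choose g hg hgl using hex
  -- Elements of `B` are combinations of the powers `c ^ i`, `i < N`, over `O_f`. The factor `f`
  -- handles the scalars, the product the denominators of the `φ (c ^ i)`.
  have hne : f * ∏ i ∈ Finset.range N, g (φ (c ^ i)) ≠ 0 :=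
    mul_ne_zero hf (Finset.prod_ne_zero_iff.2 fun _ _ => hg _)
  have hmono : ∀ h : O, h ∣ f * ∏ i ∈ Finset.range N, g (φ (c ^ i)) →
      locAway O L h ≤ locAway O L (f * ∏ i ∈ Finset.range N, g (φ (c ^ i))) := by
    intro h hh
    refine locAway_le_iff.2 (inv_mem_of_dvd (by rwa [map_ne_zero_iff _ hinj]) hh _ ?_)
    exact locAway_le_iff.1 le_rfl
  refine ⟨_, hne, fun x hx => ?_⟩
  obtain ⟨a, rfl⟩ := hN x (hle hx)
  rw [map_sum]
  refine Subalgebra.sum_mem _ fun i hi => ?_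
  obtain ⟨y, hy, hya⟩ := exists_algebraMap_eq_of_mem_locAway (L := L) hf (a i).2
  rw [← hya, ← Algebra.smul_def, map_smul, smul_eq_mul]
  exact Subalgebra.mul_mem _ (hmono f (dvd_mul_right _ _) hy)
    (hmono _ ((Finset.dvd_prod_of_mem _ hi).trans (dvd_mul_left _ _)) (hgl _))

end Functionals

/-! ### Countability of the exceptional slopes -/

section HyperplaneSections

variable {k O K : Type*} [Field k] [CommRing O] [IsDomain O]
  [Algebra k O] [Field K] [Algebra O K]
variable (L : Type*) [Field L] [CharZero L] [Algebra O L] [IsFractionRing O L] [Algebra L K]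
  [Algebra.IsAlgebraic L K] [IsScalarTower O L K]

/-- The coefficients of one Eisenstein section span a finite-dimensional `L`-space inside the span
of the coefficients of `F`, so finitely many coefficients of `F` already span it. Finite sets of
exponents are countable in number, so one serves uncountably many slopes, and interpolation applies.
-/
lemma exists_span_finset_of_hyperplaneSection {n : ℕ} {F : MvPowerSeries (Fin (n + 2)) K}
    {s : Set k} (hs : ¬ s.Countable)
    (h : ∀ a ∈ s, hyperplaneSection (algebraMap O K (algebraMap k O a)) F ∈
      eisensteinSeries O K (n + 1)) :
    ∃ T : Finset (Fin (n + 2) →₀ ℕ), ∀ m, coeff m F ∈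
      Submodule.span L ((fun m => coeff m F) '' (T : Set (Fin (n + 2) →₀ ℕ))) := by
  classical
  obtain ⟨T, hT⟩ := exists_not_countable_of_forall_exists hs
    (fun a (T : Finset (Fin (n + 2) →₀ ℕ)) => ∀ e,
      coeff e (hyperplaneSection (algebraMap O K (algebraMap k O a)) F) ∈
        Submodule.span L ((fun m => coeff m F) '' (T : Set (Fin (n + 2) →₀ ℕ)))) (by
    intro a ha
    obtain ⟨B, ⟨G, rfl⟩, hB⟩ := (mem_eisensteinSeries_iff L).1 (h a ha)
    have hfin : (Subalgebra.toSubmodule (Algebra.adjoin L (G : Set K))).FG :=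
      fg_adjoin_of_finite G.finite_toSet fun x _ => Algebra.IsIntegral.isIntegral x
    have hle : Submodule.span L (Set.range fun e =>
        coeff e (hyperplaneSection (algebraMap O K (algebraMap k O a)) F)) ≤
        Subalgebra.toSubmodule (Algebra.adjoin L (G : Set K)) := by
      rw [Submodule.span_le]
      rintro _ ⟨e, rfl⟩
      have : Algebra.adjoin O (G : Set K) ≤ (Algebra.adjoin L (G : Set K)).restrictScalars O :=
        Algebra.adjoin_le Algebra.subset_adjoin
      exact this (hB e)
    have : Module.Finite L (Subalgebra.toSubmodule (Algebra.adjoin L (G : Set K))) :=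
      Module.Finite.iff_fg.2 hfin
    have hfd := Submodule.finiteDimensional_of_le hle
    obtain ⟨V, hV⟩ := Module.Finite.iff_fg.1 hfd
    have hVs : (V : Set K) ⊆ Submodule.span L (Set.range fun m => coeff m F) := by
      have h1 : (V : Set K) ⊆ Submodule.span L (Set.range fun e =>
        coeff e (hyperplaneSection (algebraMap O K (algebraMap k O a)) F)) :=
        hV ▸ Submodule.subset_span
      refine h1.trans (Submodule.span_le.2 ?_)
      rintro _ ⟨e, rfl⟩
      dsimp only
      rw [coeff_hyperplaneSection]
      refine Submodule.sum_mem _ fun j _ => ?_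
      rw [← map_pow, ← map_pow, IsScalarTower.algebraMap_apply O L K, ← Algebra.smul_def]
      exact Submodule.smul_mem _ _ (Submodule.subset_span ⟨_, rfl⟩)
    obtain ⟨U, hU, hVU⟩ := Submodule.subset_span_finite_of_subset_span hVs
    rw [← Set.image_univ, Finset.subset_set_image_iff] at hU
    obtain ⟨T, -, rfl⟩ := hU
    refine ⟨T, fun e => ?_⟩
    have h2 := hV ▸ Submodule.span_le.2 hVU
    rw [Finset.coe_image] at h2
    exact h2 (Submodule.subset_span ⟨e, rfl⟩))
  refine ⟨T, coeff_mem_of_infinite_hyperplaneSection (O := O)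
    ((Submodule.span L _).restrictScalars O) (fun hfin => hT hfin.countable) ?_⟩
  rintro a ⟨-, ha⟩ e
  exact ha e

variable [UniqueFactorizationMonoid O]

/-- For each slope some `O_f` contains the values of `φ`, with `f` depending on the slope. By
`exists_denominators`, `f` can be taken among the products of the `q i` over finite sets, so a
single product serves uncountably many slopes. -/
lemma exists_functional_coeff_mem_locAway {n : ℕ} {F : MvPowerSeries (Fin (n + 2)) K}
    {s : Set k} (hs : ¬ s.Countable)
    (h : ∀ a ∈ s, hyperplaneSection (algebraMap O K (algebraMap k O a)) F ∈
      eisensteinSeries O K (n + 1)) (φ : K →ₗ[L] L) :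
    ∃ q : O, q ≠ 0 ∧ ∀ m, φ (coeff m F) ∈ locAway O L q := by
  obtain ⟨q, hq, hqT⟩ := exists_denominators (O := O) fun m => φ (coeff m F)
  obtain ⟨T, hT⟩ := exists_not_countable_of_forall_exists hs
    (fun a (T : Finset (Fin (n + 2) →₀ ℕ)) => ∀ e,
      φ (coeff e (hyperplaneSection (algebraMap O K (algebraMap k O a)) F)) ∈
        locAway O L (∏ i ∈ T, q i)) (by
    intro a ha
    obtain ⟨B, hB, hBa⟩ := (mem_eisensteinSeries_iff L).1 (h a ha)
    obtain ⟨f, hf, hfφ⟩ := exists_forall_functional_mem_locAway φ hB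
    obtain ⟨T, hT⟩ := hqT f hf
    refine ⟨T, fun e => hT _ ?_ (hfφ _ (hBa e))⟩
    rw [coeff_hyperplaneSection, map_sum]
    refine Submodule.sum_mem _ fun j _ => ?_
    rw [← map_pow, ← map_pow, IsScalarTower.algebraMap_apply O L K, ← Algebra.smul_def, map_smul,
      algebraMap_smul]
    exact Submodule.smul_mem _ _ (Submodule.subset_span ⟨_, rfl⟩))
  refine ⟨∏ i ∈ T, q i, Finset.prod_ne_zero_iff.2 fun i _ => hq i,
    coeff_mem_of_infinite_hyperplaneSection (O := O)
      ((Subalgebra.toSubmodule (locAway O L (∏ i ∈ T, q i))).comap (φ.restrictScalars O))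
      (fun hfin => hT hfin.countable) ?_⟩
  rintro a ⟨-, ha⟩ e
  exact ha e

include L in
/-- A series that is not an Eisenstein series has only countably many Eisenstein sections
`xₙ = λ x₁` with `λ ∈ k`. -/
theorem countable_hyperplaneSection_mem {n : ℕ} {F : MvPowerSeries (Fin (n + 2)) K}
    (hF : F ∉ eisensteinSeries O K (n + 2)) :
    {a : k | hyperplaneSection (algebraMap O K (algebraMap k O a)) F ∈
      eisensteinSeries O K (n + 1)}.Countable := by
  classical
  by_contra hs
  obtain ⟨T, hT⟩ := exists_span_finset_of_hyperplaneSection (O := O) L hs fun a ha => ha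
  set V := Submodule.span L ((fun m => coeff m F) '' (T : Set (Fin (n + 2) →₀ ℕ))) with hV
  have : FiniteDimensional L V :=
    FiniteDimensional.span_of_finite L (T.finite_toSet.image _)
  -- A linear retraction of `K` onto `V` extends the coordinates on `V` to functionals on `K`. Their
  -- denominators, together with the basis vectors, generate the required algebra.
  obtain ⟨p, hp⟩ := V.subtype.exists_leftInverse_of_injective V.ker_subtype
  let b := Module.finBasis L V
  choose q hq hqφ using fun i => exists_functional_coeff_mem_locAway (O := O) L hs (fun a ha => ha)
    (b.coord i ∘ₗ p)
  refine hF ((mem_eisensteinSeries_iff L).2 ⟨Algebra.adjoin O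
    ((Set.range fun i => (algebraMap O K (q i))⁻¹) ∪ Set.range fun i => (b i : K)),
    Subalgebra.fg_def.2 ⟨_, (Set.finite_range _).union (Set.finite_range _), rfl⟩, fun m => ?_⟩)
  have hsum : coeff m F = ∑ i, algebraMap L K (b.coord i (p (coeff m F))) * (b i : K) := by
    have h1 : p (coeff m F) = ⟨coeff m F, hT m⟩ := LinearMap.congr_fun hp ⟨coeff m F, hT m⟩
    have h2 := congrArg V.subtype (b.sum_repr ⟨coeff m F, hT m⟩)
    rw [map_sum] at h2
    rw [h1]
    simp only [← Algebra.smul_def]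
    exact h2.symm
  rw [hsum]
  refine Subalgebra.sum_mem _ fun i _ => Subalgebra.mul_mem _ ?_
    (Algebra.subset_adjoin (Set.mem_union_right _ ⟨i, rfl⟩))
  have hle : locAway O L (q i) ≤ (Algebra.adjoin O ((Set.range fun i => (algebraMap O K (q i))⁻¹) ∪
      Set.range fun i => (b i : K))).comap (IsScalarTower.toAlgHom O L K) := by
    rw [locAway_le_iff, Subalgebra.mem_comap, IsScalarTower.coe_toAlgHom', map_inv₀,
      ← IsScalarTower.algebraMap_apply]
    exact Algebra.subset_adjoin (Set.mem_union_left _ ⟨i, rfl⟩)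
  exact hle (hqφ i m)

end HyperplaneSections

/-! ### Polynomials with prescribed roots, and their reductions -/

section PolySeries

/-- The embedding `R[t] → R⟦t⟧`. -/
noncomputable def polySeries (R : Type*) [CommRing R] : Polynomial R →+* MvPowerSeries (Fin 1) R :=
  (Polynomial.aeval (X 0 : MvPowerSeries (Fin 1) R)).toRingHom

lemma polyToSeries_eq (K : Type*) [Field K] : polyToSeries K = polySeries K := rfl

variable {R S : Type*} [CommRing R] [CommRing S]

lemma exp_one_eq (m : Fin 1 →₀ ℕ) : m = Finsupp.single 0 (m 0) := by ext; simp

lemma coeff_polySeries (p : Polynomial R) (m : Fin 1 →₀ ℕ) :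
    coeff m (polySeries R p) = p.coeff (m 0) := by
  classical
  induction p using Polynomial.induction_on' with
  | add p q hp hq => simp [hp, hq]
  | monomial i a =>
    have : polySeries R (Polynomial.monomial i a) = C a * X 0 ^ i := by
      simp [polySeries, MvPowerSeries.algebraMap_apply]
    rw [this, X_pow_eq, coeff_C_mul, coeff_monomial, Polynomial.coeff_monomial]
    by_cases h : i = m 0
    · rw [if_pos h, if_pos, mul_one]
      rw [h, ← exp_one_eq]
    · rw [if_neg h, if_neg, mul_zero]
      rintro rfl
      simp at h

lemma polySeries_injective : Function.Injective (polySeries R) := by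
  intro p q h
  ext i
  have := congrArg (coeff (Finsupp.single 0 i)) h
  simpa [coeff_polySeries] using this

lemma map_comp_polySeries (f : R →+* S) :
    (MvPowerSeries.map (σ := Fin 1) f).comp (polySeries R) =
      (polySeries S).comp (Polynomial.mapRingHom f) := by
  ext p m <;> simp [coeff_polySeries, Polynomial.coeff_C, Polynomial.coeff_X, apply_ite f]

lemma map_eval₂_polySeries (f : R →+* S) (P : Polynomial (Polynomial R))
    (g : MvPowerSeries (Fin 1) R) :
    MvPowerSeries.map f (P.eval₂ (polySeries R) g) =
      (P.map (Polynomial.mapRingHom f)).eval₂ (polySeries S) (MvPowerSeries.map f g) := by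
  rw [Polynomial.hom_eval₂, map_comp_polySeries, Polynomial.eval₂_map]

lemma map_map_polySeries (f : R →+* S) (P : Polynomial (Polynomial R)) :
    (P.map (polySeries R)).map (MvPowerSeries.map (σ := Fin 1) f) =
      (P.map (Polynomial.mapRingHom f)).map (polySeries S) := by
  rw [Polynomial.map_map, map_comp_polySeries, Polynomial.map_map]

lemma mem_range_polySeries {h : MvPowerSeries (Fin 1) R} {D : ℕ}
    (hD : ∀ m, D < m 0 → coeff m h = 0) : h ∈ Set.range (polySeries R) := by
  refine ⟨∑ l ∈ Finset.range (D + 1), Polynomial.monomial l (coeff (Finsupp.single 0 l) h), ?_⟩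
  ext m
  rw [coeff_polySeries, Polynomial.finsetSum_coeff]
  simp only [Polynomial.coeff_monomial, Finset.sum_ite_eq', Finset.mem_range]
  split_ifs with hm
  · rw [← exp_one_eq]
  · rw [hD m (by omega)]

lemma coeff_swap (P : Polynomial (Polynomial R)) (i j : ℕ) :
    ((Polynomial.Bivariate.swap P).coeff i).coeff j = (P.coeff j).coeff i := by
  induction P using Polynomial.induction_on' with
  | add p q hp hq => simp [hp, hq]
  | monomial n p =>
    induction p using Polynomial.induction_on' with
    | add p q hp hq => simp only [map_add, Polynomial.coeff_add, hp, hq]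
    | monomial l a =>
      rw [Polynomial.Bivariate.swap_monomial_monomial]
      simp only [Polynomial.coeff_monomial]
      by_cases h1 : l = i <;> by_cases h2 : n = j <;> simp [h1, h2, Polynomial.coeff_monomial]

lemma natDegree_swap_le_iff {P : Polynomial (Polynomial R)} {D : ℕ} :
    (Polynomial.Bivariate.swap P).natDegree ≤ D ↔ ∀ j, (P.coeff j).natDegree ≤ D := by
  simp only [Polynomial.natDegree_le_iff_coeff_eq_zero]
  constructor
  · intro h j N hN
    rw [← coeff_swap, h N hN, Polynomial.coeff_zero]
  · intro h N hN
    ext j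
    rw [coeff_swap, h j N hN, Polynomial.coeff_zero]

/-- Exchanging `t` and `z` turns the degree in `t` into an ordinary degree, which is additive over a
domain. -/
lemma natDegree_coeff_le_of_dvd [IsDomain R] {P Q : Polynomial (Polynomial R)} (hPQ : P ∣ Q)
    (hQ : Q ≠ 0) {D : ℕ} (hD : ∀ j, (Q.coeff j).natDegree ≤ D) (j : ℕ) :
    (P.coeff j).natDegree ≤ D := by
  revert j
  rw [← natDegree_swap_le_iff] at hD ⊢
  obtain ⟨N, rfl⟩ := hPQ
  rw [map_mul, Polynomial.natDegree_mul] at hD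
  · omega
  · exact (map_ne_zero_iff _ (Polynomial.Bivariate.swap (R := R)).injective).2 (left_ne_zero_of_mul hQ)
  · exact (map_ne_zero_iff _ (Polynomial.Bivariate.swap (R := R)).injective).2 (right_ne_zero_of_mul hQ)

end PolySeries

/-! ### Partial products of linear factors -/

section NoFactor

variable {ι : Type*}

/-- The partial product `∏_{i ∈ S} (z - γᵢ)`. -/
noncomputable def partialProd {R : Type*} [CommRing R] (γ : ι → R) (S : Finset ι) : Polynomial R :=
  ∏ i ∈ S, (Polynomial.X - Polynomial.C (γ i))

lemma map_partialProd {R S : Type*} [CommRing R] [CommRing S] (f : R →+* S) (γ : ι → R)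
    (T : Finset ι) : (partialProd γ T).map f = partialProd (fun i => f (γ i)) T := by
  simp [partialProd, Polynomial.map_prod]

lemma partialProd_monic {R : Type*} [CommRing R] (γ : ι → R) (S : Finset ι) :
    (partialProd γ S).Monic :=
  Polynomial.monic_prod_of_monic _ _ fun i _ => Polynomial.monic_X_sub_C (γ i)

lemma natDegree_partialProd {R : Type*} [CommRing R] [Nontrivial R] (γ : ι → R) (S : Finset ι) :
    (partialProd γ S).natDegree = S.card := by
  rw [partialProd, Polynomial.natDegree_prod_of_monic _ _ fun i _ => Polynomial.monic_X_sub_C (γ i)]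
  simp

/-- The linear factors are prime, so a divisor is a unit times a partial product; monicity makes the
unit equal to `1`. -/
lemma exists_eq_partialProd_of_dvd [DecidableEq ι] {R : Type*} [CommRing R] [IsDomain R] {γ : ι → R}
    {P : Polynomial R} (hP : P.Monic) {T : Finset ι} (h : P ∣ partialProd γ T) :
    ∃ S ⊆ T, P = partialProd γ S := by
  obtain ⟨N, hN⟩ := h
  obtain ⟨S, U, b, c, hSU, -, hbc, hP', -⟩ := mul_eq_mul_prime_prod (x := P) (y := N) (a := 1)
    (s := T) (p := fun i => Polynomial.X - Polynomial.C (γ i))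
    (fun i _ => Polynomial.prime_X_sub_C (γ i)) (by rw [one_mul, ← hN]; rfl)
  refine ⟨S, hSU ▸ Finset.subset_union_left, ?_⟩
  have hb : b.Monic := (partialProd_monic γ S).of_mul_monic_right (p := b) (by
    rw [partialProd, ← hP']; exact hP)
  rw [hP', hb.eq_one_of_isUnit (IsUnit.of_mul_eq_one c hbc.symm), one_mul, partialProd]

variable [Fintype ι]

/-- If no proper partial product of `Γ = ∏ (z - γᵢ)` is a polynomial in `t` of small degree, then
a root of `Γ` is not a root of a polynomial of degree less than that of `Γ`. -/
theorem eq_zero_of_eval₂_eq_zero {k : Type*} [Field k] {Γ : Polynomial (Polynomial k)}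
    (hΓ : Γ.Monic) {γ : ι → MvPowerSeries (Fin 1) k}
    (hprod : Γ.map (polySeries k) = partialProd γ Finset.univ) {D : ℕ}
    (hD : ∀ j, (Γ.coeff j).natDegree ≤ D)
    (hS : ∀ S : Finset ι, S.Nonempty → S ≠ Finset.univ →
      ∃ j m, D < m 0 ∧ coeff m ((partialProd γ S).coeff j) ≠ 0)
    {g : MvPowerSeries (Fin 1) k} (hg : Γ.eval₂ (polySeries k) g = 0)
    {p : Polynomial (Polynomial k)} (hp : p.degree < Γ.degree)
    (hpg : p.eval₂ (polySeries k) g = 0) : p = 0 := by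
  classical
  let _ : Algebra (Polynomial k) (MvPowerSeries (Fin 1) k) := (polySeries k).toAlgebra
  have hfaith : FaithfulSMul (Polynomial k) (MvPowerSeries (Fin 1) k) :=
    (faithfulSMul_iff_algebraMap_injective _ _).2 polySeries_injective
  have : IsDomain (MvPowerSeries (Fin 1) k) := NoZeroDivisors.to_isDomain _
  have hint : IsIntegral (Polynomial k) g := ⟨Γ, hΓ, hg⟩
  by_contra hp0
  -- The minimal polynomial of `g` over `k[t]` divides `Γ`, so it is a partial product of degree at
  -- most `D` in `t`; dividing `p ≠ 0`, it is a proper one. Irreducibility of `Γ` would be too much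
  -- to ask, since the result is also applied over residue fields.
  have hdvd : minpoly (Polynomial k) g ∣ p := minpoly.isIntegrallyClosed_dvd hint hpg
  have hdvd' : minpoly (Polynomial k) g ∣ Γ := minpoly.isIntegrallyClosed_dvd hint hg
  have hmon := minpoly.monic hint
  obtain ⟨S, -, hPS⟩ := exists_eq_partialProd_of_dvd (γ := γ) (T := Finset.univ)
    (hmon.map (polySeries k)) (hprod ▸ Polynomial.map_dvd _ hdvd')
  have hdeg : (minpoly (Polynomial k) g).natDegree = S.card := by
    rw [← hmon.natDegree_map (polySeries k), hPS, natDegree_partialProd]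
  have hdegΓ : Γ.natDegree = Fintype.card ι := by
    rw [← hΓ.natDegree_map (polySeries k), hprod, natDegree_partialProd, Finset.card_univ]
  obtain ⟨j, m, hm, hne⟩ := hS S
    (by rw [← Finset.card_pos, ← hdeg]; exact minpoly.natDegree_pos hint)
    (by
      rintro rfl
      have h1 := Polynomial.natDegree_le_of_dvd hdvd hp0
      have h2 := Polynomial.natDegree_lt_natDegree hp0 hp
      rw [Finset.card_univ] at hdeg
      omega)
  rw [← hPS, Polynomial.coeff_map, coeff_polySeries] at hne
  exact hne (Polynomial.coeff_eq_zero_of_natDegree_lt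
    ((natDegree_coeff_le_of_dvd hdvd' hΓ.ne_zero hD j).trans_lt hm))

/-- Proper partial products of an irreducible `Γ` are not polynomials in `t`. -/
lemma exists_coeff_partialProd_ne_zero {k : Type*} [Field k] {Γ : Polynomial (Polynomial k)}
    (hirr : Irreducible Γ) (hΓ : Γ.Monic) {γ : ι → MvPowerSeries (Fin 1) k}
    (hprod : Γ.map (polySeries k) = partialProd γ Finset.univ) (D : ℕ)
    {S : Finset ι} (hS : S.Nonempty) (hS' : S ≠ Finset.univ) :
    ∃ j m, D < m 0 ∧ coeff m ((partialProd γ S).coeff j) ≠ 0 := by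
  by_contra! hcon
  obtain ⟨P, hP⟩ : ∃ P : Polynomial (Polynomial k), P.map (polySeries k) = partialProd γ S := by
    rw [← Polynomial.mem_lifts, Polynomial.lifts_iff_coeff_lifts]
    exact fun j => mem_range_polySeries (hcon j)
  have hPm : P.Monic :=
    Polynomial.monic_of_injective polySeries_injective (hP ▸ partialProd_monic γ S)
  have hdvd : P ∣ Γ := by
    rw [← Polynomial.map_dvd_map _ polySeries_injective hPm, hP, hprod]
    exact Finset.prod_dvd_prod_of_subset _ _ _ (Finset.subset_univ S)
  have hdeg : P.natDegree = S.card := by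
    rw [← hPm.natDegree_map (polySeries k), hP, natDegree_partialProd]
  have hdegΓ : Γ.natDegree = Fintype.card ι := by
    rw [← hΓ.natDegree_map (polySeries k), hprod, natDegree_partialProd, Finset.card_univ]
  obtain ⟨N, hN⟩ := hdvd
  have hNm : N.Monic := hPm.of_mul_monic_left (hN ▸ hΓ)
  rcases hirr.isUnit_or_isUnit hN with h | h
  · rw [hPm.eq_one_of_isUnit h, Polynomial.natDegree_one] at hdeg
    exact hS.card_pos.ne hdeg
  · rw [hN, hNm.eq_one_of_isUnit h, mul_one, hdeg, Finset.card_eq_iff_eq_univ] at hdegΓ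
    exact hS' hdegΓ

end NoFactor

/-! ### Lifting coefficients to a subring -/

section Lifting

lemma exists_map_eq_of_coeff_mem {σ K : Type*} [CommRing K] (V : Subring K)
    {h : MvPowerSeries σ K} (hh : ∀ m, coeff m h ∈ V) :
    ∃ h' : MvPowerSeries σ V, MvPowerSeries.map V.subtype h' = h := by
  let h' : MvPowerSeries σ V := fun m => ⟨coeff m h, hh m⟩
  refine ⟨h', ?_⟩
  ext m
  rw [coeff_map]
  rfl

lemma map_injective_of_injective {σ R S : Type*} [CommRing R] [CommRing S] {f : R →+* S}
    (hf : Function.Injective f) : Function.Injective (MvPowerSeries.map (σ := σ) f) := by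
  intro g h hgh
  ext m
  have := congrArg (coeff m) hgh
  rw [coeff_map, coeff_map] at this
  exact hf this

lemma mapRingHom_injective {R S : Type*} [CommRing R] [CommRing S] {f : R →+* S}
    (hf : Function.Injective f) : Function.Injective (Polynomial.mapRingHom f) :=
  Polynomial.map_injective f hf

lemma exists_bivariate_map_eq {K : Type*} [CommRing K] (V : Subring K)
    {P : Polynomial (Polynomial K)} (hP : ∀ j l, (P.coeff j).coeff l ∈ V) :
    ∃ P' : Polynomial (Polynomial V), P'.map (Polynomial.mapRingHom V.subtype) = P := by
  rw [← Polynomial.mem_lifts, Polynomial.lifts_iff_coeff_lifts]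
  intro j
  have : P.coeff j ∈ Polynomial.lifts V.subtype := by
    rw [Polynomial.lifts_iff_coeff_lifts]
    exact fun l => ⟨⟨_, hP j l⟩, rfl⟩
  obtain ⟨q, hq⟩ := (Polynomial.mem_lifts _).1 this
  exact ⟨q, hq⟩

end Lifting

/-! ### Reduction modulo the maximal ideal of a valuation ring -/

section ValuationRing

variable {K : Type*} [Field K]

/-- A nonzero bivariate polynomial has a coefficient of maximal valuation. -/
lemma exists_coeff_valuation_max (V : ValuationSubring K) {P : Polynomial (Polynomial K)} (j l : ℕ)
    (h : (P.coeff j).coeff l ∉ V) :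
    ∃ j₀ l₀, (P.coeff j₀).coeff l₀ ∉ V ∧
      ∀ j l, ((P.coeff j₀).coeff l₀)⁻¹ * (P.coeff j).coeff l ∈ V := by
  classical
  let T := P.support.sigma fun j => (P.coeff j).support
  have hT : ∀ j l, (P.coeff j).coeff l ≠ 0 → (⟨j, l⟩ : Σ _ : ℕ, ℕ) ∈ T := by
    intro j l hjl
    simp only [T, Finset.mem_sigma, Polynomial.mem_support_iff]
    exact ⟨fun h0 => hjl (by simp [h0]), hjl⟩
  have hne : (P.coeff j).coeff l ≠ 0 := fun h0 => h (h0 ▸ V.zero_mem)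
  obtain ⟨⟨j₀, l₀⟩, -, hmax⟩ := Finset.exists_max_image T
    (fun x => V.valuation ((P.coeff x.1).coeff x.2)) ⟨_, hT j l hne⟩
  have hgt : 1 < V.valuation ((P.coeff j₀).coeff l₀) := by
    rw [← V.valuation_le_one_iff, not_le] at h
    exact h.trans_le (hmax _ (hT j l hne))
  refine ⟨j₀, l₀, ?_, fun j' l' => ?_⟩
  · rwa [← V.valuation_le_one_iff, not_le]
  · by_cases h0 : (P.coeff j').coeff l' = 0
    · rw [h0, mul_zero]; exact V.zero_mem
    · rw [← V.valuation_le_one_iff, map_mul, map_inv₀]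
      exact inv_mul_le_one_of_le₀ (hmax _ (hT j' l' h0)) zero_le

variable {ι : Type*} [Fintype ι]

/-- If the proper partial products of `Γ` stay non-polynomial modulo the maximal ideal of a
valuation ring `V`, then a polynomial `r` of degree less than that of `Γ` has its coefficients in
`V` as soon as its value at some root of `Γ` has. -/
theorem coeff_mem_valuationSubring (V : ValuationSubring K) {Γ : Polynomial (Polynomial K)}
    (hΓ : Γ.Monic) {γ : ι → MvPowerSeries (Fin 1) K}
    (hprod : Γ.map (polySeries K) = partialProd γ Finset.univ) {D : ℕ}
    (hD : ∀ j, (Γ.coeff j).natDegree ≤ D)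
    (hγ : ∀ i m, coeff m (γ i) ∈ V)
    (hS : ∀ S : Finset ι, S.Nonempty → S ≠ Finset.univ →
      ∃ j m, D < m 0 ∧ coeff m ((partialProd γ S).coeff j) ≠ 0 ∧
        (coeff m ((partialProd γ S).coeff j))⁻¹ ∈ V)
    {g : MvPowerSeries (Fin 1) K} (hg : Γ.eval₂ (polySeries K) g = 0)
    (hgV : ∀ m, coeff m g ∈ V)
    {r : Polynomial (Polynomial K)} (hr : r.degree < Γ.degree)
    (hrg : ∀ m, coeff m (r.eval₂ (polySeries K) g) ∈ V) (j l : ℕ) :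
    (r.coeff j).coeff l ∈ V := by
  by_contra hjl
  obtain ⟨j₀, l₀, hx, hmax⟩ := exists_coeff_valuation_max V j l hjl
  set x := (r.coeff j₀).coeff l₀ with hxdef
  have hx0 : x ≠ 0 := fun h0 => hx (h0 ▸ V.zero_mem)
  have hxinv : x⁻¹ ∈ V := (V.mem_or_inv_mem x).resolve_left hx
  let f : V.toSubring →+* K := V.toSubring.subtype
  have hf : Function.Injective f := Subtype.val_injective
  have hres : IsLocalRing V.toSubring := inferInstanceAs (IsLocalRing V)
  let κ := IsLocalRing.ResidueField V.toSubring
  let res : V.toSubring →+* κ := IsLocalRing.residue V.toSubring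
  choose γ' hγ' using fun i => exists_map_eq_of_coeff_mem V.toSubring (hγ i)
  obtain ⟨g', hg'⟩ := exists_map_eq_of_coeff_mem V.toSubring hgV
  obtain ⟨h', hh'⟩ := exists_map_eq_of_coeff_mem V.toSubring hrg
  have hpp : ∀ S, partialProd γ S = (partialProd γ' S).map (MvPowerSeries.map f) := by
    intro S
    rw [map_partialProd]
    exact congrArg (fun γ => partialProd γ S) (funext fun i => (hγ' i).symm)
  obtain ⟨Γ', hΓ'⟩ := exists_bivariate_map_eq V.toSubring (P := Γ) (by
    intro j l
    have h1 : (Γ.coeff j).coeff l =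
        coeff (Finsupp.single 0 l) ((Γ.map (polySeries K)).coeff j) := by
      rw [Polynomial.coeff_map, coeff_polySeries, Finsupp.single_eq_same]
    rw [h1, hprod, hpp, Polynomial.coeff_map, coeff_map]
    exact Subtype.property _)
  -- Dividing by the largest coefficient `x` gives a polynomial over the valuation ring with one
  -- coefficient equal to `1`.
  obtain ⟨r', hr'⟩ := exists_bivariate_map_eq V.toSubring
    (P := Polynomial.C (Polynomial.C x⁻¹) * r) (by
    intro j l
    rw [Polynomial.coeff_C_mul, Polynomial.coeff_C_mul]
    exact hmax j l)
  have hΓ'm : Γ'.Monic := Polynomial.monic_of_injective (mapRingHom_injective hf) (by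
    rw [hΓ']; exact hΓ)
  have hprod' : Γ'.map (polySeries _) = partialProd γ' Finset.univ := by
    apply Polynomial.map_injective _ (map_injective_of_injective (σ := Fin 1) hf)
    rw [map_map_polySeries, hΓ', hprod, hpp]
  have hev : r'.eval₂ (polySeries _) g' = C ⟨x⁻¹, hxinv⟩ * h' := by
    apply map_injective_of_injective (σ := Fin 1) hf
    rw [map_eval₂_polySeries, hr', hg', Polynomial.eval₂_mul, Polynomial.eval₂_C, map_mul, hh',
      map_C]
    congr 1
    simp [polySeries, MvPowerSeries.algebraMap_apply]
    rfl
  have hresx : res ⟨x⁻¹, hxinv⟩ = 0 := by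
    rw [IsLocalRing.residue_eq_zero_iff, IsLocalRing.mem_maximalIdeal, mem_nonunits_iff]
    intro hu
    obtain ⟨y, hy⟩ := hu.exists_right_inv
    have hy' : x⁻¹ * (y : K) = 1 := congrArg Subtype.val hy
    have : x = y := by field_simp at hy'; exact hy'.symm
    exact hx (this ▸ y.2)
  -- Since `x⁻¹` reduces to zero, the value of `r'` at the root reduces to zero too, while the
  -- reduced `Γ` keeps its degree and its linear factors. Its proper partial products keep a nonzero
  -- coefficient beyond `D`, because that coefficient is a unit of `V`.
  have hzero : r'.map (Polynomial.mapRingHom res) = 0 := by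
    refine eq_zero_of_eval₂_eq_zero (Γ := Γ'.map (Polynomial.mapRingHom res))
      (γ := fun i => MvPowerSeries.map res (γ' i)) (D := D) (g := MvPowerSeries.map res g')
      (hΓ'm.map _) ?_ ?_ ?_ ?_ ?_ ?_
    · rw [← map_map_polySeries, hprod', map_partialProd]
    · intro j
      rw [Polynomial.coeff_map, Polynomial.coe_mapRingHom]
      refine Polynomial.natDegree_map_le.trans ?_
      have := hD j
      rw [← hΓ', Polynomial.coeff_map, Polynomial.coe_mapRingHom,
        Polynomial.natDegree_map_eq_of_injective hf] at this
      exact this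
    · intro S hSn hSu
      obtain ⟨j, m, hm, hne, hinv⟩ := hS S hSn hSu
      refine ⟨j, m, hm, ?_⟩
      rw [← map_partialProd, Polynomial.coeff_map, coeff_map]
      rw [hpp, Polynomial.coeff_map, coeff_map] at hne hinv
      have hu : IsUnit (coeff m ((partialProd γ' S).coeff j)) :=
        IsUnit.of_mul_eq_one ⟨_, hinv⟩ (Subtype.ext (mul_inv_cancel₀ hne))
      exact (hu.map res).ne_zero
    · rw [← map_eval₂_polySeries]
      have : Γ'.eval₂ (polySeries _) g' = 0 := by
        apply map_injective_of_injective (σ := Fin 1) hf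
        rw [map_eval₂_polySeries, hΓ', hg', hg, map_zero]
      rw [this, map_zero]
    · have h1 : (Γ'.map (Polynomial.mapRingHom res)).degree = Γ.degree := by
        rw [hΓ'm.degree_map, ← hΓ', hΓ'm.degree_map]
      rw [h1]
      refine lt_of_le_of_lt (Polynomial.degree_map_le) (lt_of_le_of_lt ?_ hr)
      rw [← Polynomial.degree_map_eq_of_injective (mapRingHom_injective hf) r', hr']
      rw [Polynomial.degree_C_mul (Polynomial.C_ne_zero.2 (inv_ne_zero hx0))]
    · rw [← map_eval₂_polySeries, hev, map_mul, map_C, hresx, map_zero, zero_mul]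
  have h1 : (r'.coeff j₀).coeff l₀ = 1 := by
    apply hf
    have := congrArg (fun P => (Polynomial.coeff P j₀).coeff l₀) hr'
    simp only [Polynomial.coeff_map, Polynomial.coe_mapRingHom, Polynomial.coeff_C_mul] at this
    rw [map_one]
    exact this.trans (inv_mul_cancel₀ hx0)
  have h2 := congrArg (fun P => (Polynomial.coeff P j₀).coeff l₀) hzero
  simp only [Polynomial.coeff_map, Polynomial.coe_mapRingHom, h1, map_one,
    Polynomial.coeff_zero] at h2
  exact one_ne_zero h2

end ValuationRing

/-! ### Descent of coefficients to a subfield -/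

section Retraction

variable {K : Type*} [Field K]

lemma exists_polynomial_coeff_eq {R S : Type*} [Semiring R] [Semiring S] (ρ : R → S) (h0 : ρ 0 = 0)
    (p : Polynomial R) : ∃ q : Polynomial S, ∀ i, q.coeff i = ρ (p.coeff i) := by
  refine ⟨∑ i ∈ Finset.range (p.natDegree + 1), Polynomial.monomial i (ρ (p.coeff i)), fun i => ?_⟩
  simp only [Polynomial.finsetSum_coeff, Polynomial.coeff_monomial, Finset.sum_ite_eq',
    Finset.mem_range]
  split_ifs with h
  · rfl
  · rw [Polynomial.coeff_eq_zero_of_natDegree_lt (by omega), h0]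

/-- The coefficients of a polynomial determined by its value at `g` lie in every field that
contains the coefficients of `g` and of this value. -/
theorem coeff_mem_subfield {L : Type*} [Field L] [Algebra L K] (E : IntermediateField L K)
    {g : MvPowerSeries (Fin 1) K} (hg : ∀ m, coeff m g ∈ E) {N : ℕ}
    (huniq : ∀ p : Polynomial (Polynomial K), p.degree < N → p.eval₂ (polySeries K) g = 0 → p = 0)
    {r : Polynomial (Polynomial K)} (hr : r.degree < N)
    (hrg : ∀ m, coeff m (r.eval₂ (polySeries K) g) ∈ E) (j l : ℕ) : (r.coeff j).coeff l ∈ E := by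
  classical
  -- An `E`-linear retraction of `K` onto `E`, applied to the coefficients of `r`, leaves the value
  -- at `g` unchanged because `g` and this value have coefficients in `E`. Uniqueness then forces
  -- `r` to be fixed.
  obtain ⟨ρ, hρ⟩ := (Algebra.linearMap E K).exists_leftInverse_of_injective
    (LinearMap.ker_eq_bot.2 (algebraMap E K).injective)
  have hρE : ∀ x : E, (ρ x : K) = x := fun x => congrArg Subtype.val (LinearMap.congr_fun hρ x)
  have hρmul : ∀ (x : K), ∀ e ∈ E, (ρ (x * e) : K) = ρ x * e := by
    intro x e he
    have := ρ.map_smul ⟨e, he⟩ x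
    rw [Algebra.smul_def, mul_comm] at this
    rw [mul_comm (ρ x : K)]
    exact congrArg Subtype.val this
  choose ψ hψ using exists_polynomial_coeff_eq (fun x : K => (ρ x : K)) (by simp)
  have hψ0 : ψ 0 = 0 := by ext i; simp [hψ]
  obtain ⟨r', hr'⟩ := exists_polynomial_coeff_eq ψ hψ0 r
  have hr'N : r'.degree < N := by
    rw [Polynomial.degree_lt_iff_coeff_zero] at hr ⊢
    intro i hi
    rw [hr', hr i hi, hψ0]
  have hpow : ∀ i m, coeff m (g ^ i) ∈ E := by
    intro i
    induction i with
    | zero =>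
      intro m
      rw [pow_zero, coeff_one]
      split_ifs
      · exact one_mem E
      · exact zero_mem E
    | succ i ih =>
      intro m
      rw [pow_succ, coeff_mul]
      exact sum_mem fun p _ => mul_mem (ih _) (hg _)
  have hnat : ∀ p : Polynomial (Polynomial K), p.degree < N → p.natDegree < N + 1 := fun p hp =>
    Nat.lt_succ_of_le (Polynomial.natDegree_le_of_degree_le hp.le)
  have hev : r'.eval₂ (polySeries K) g = r.eval₂ (polySeries K) g := by
    ext m
    refine Eq.trans ?_ (hρE ⟨_, hrg m⟩)
    dsimp only
    rw [Polynomial.eval₂_eq_sum_range' _ (hnat _ hr), Polynomial.eval₂_eq_sum_range' _ (hnat _ hr'N),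
      map_sum, map_sum, map_sum, AddSubmonoidClass.coe_finsetSum]
    refine Finset.sum_congr rfl fun i _ => ?_
    rw [coeff_mul, coeff_mul, map_sum, AddSubmonoidClass.coe_finsetSum]
    refine Finset.sum_congr rfl fun p _ => ?_
    rw [coeff_polySeries, coeff_polySeries, hρmul _ _ (hpow _ _), hr', hψ]
  have hsub : r' - r = 0 := huniq _ ((Polynomial.degree_sub_le _ _).trans_lt (max_lt hr'N hr))
    (by rw [Polynomial.eval₂_sub, hev, sub_self])
  rw [← sub_eq_zero.1 hsub, hr', hψ]
  exact Subtype.property _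

end Retraction

/-! ### Temperateness -/

section Temperate

lemma coeff_mul_inSecond {K : Type*} [Field K] (A : MvPowerSeries (Fin 2) K)
    (h : MvPowerSeries (Fin 1) K) (q : Polynomial K) (m : Fin 2 →₀ ℕ)
    (hA : ∀ e : Fin 2 →₀ ℕ, e 0 = m 0 → coeff e A = q.coeff (e 1)) :
    coeff m (A * inSecond h) = coeff (Finsupp.single 0 (m 1)) (polySeries K q * h) := by
  classical
  rw [coeff_mul, coeff_mul]
  symm
  refine Finset.sum_of_injOn (fun p : (Fin 1 →₀ ℕ) × (Fin 1 →₀ ℕ) =>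
    ((Finsupp.single 0 (m 0) + Finsupp.single 1 (p.1 0) : Fin 2 →₀ ℕ),
      (Finsupp.single 1 (p.2 0) : Fin 2 →₀ ℕ))) ?_ ?_ ?_ ?_
  · rintro ⟨a, b⟩ - ⟨a', b'⟩ - hab
    rw [Prod.mk.injEq] at hab
    have h1 := DFunLike.congr_fun hab.1 1
    have h2 := DFunLike.congr_fun hab.2 1
    simp at h1 h2
    rw [Prod.mk.injEq, exp_one_eq a, exp_one_eq a', exp_one_eq b, exp_one_eq b', h1, h2]
    exact ⟨rfl, rfl⟩
  · rintro ⟨a, b⟩ hab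
    simp only [Finset.mem_coe, Finset.HasAntidiagonal.mem_antidiagonal] at hab ⊢
    have h1 := DFunLike.congr_fun hab 0
    simp at h1
    ext i
    fin_cases i
    · simp
    · simpa using h1
  · rintro ⟨a, b⟩ hab hnot
    rw [Finset.HasAntidiagonal.mem_antidiagonal] at hab
    dsimp only at hab ⊢
    rw [coeff_inSecond]
    split_ifs with hb
    · exfalso
      apply hnot
      refine ⟨(Finsupp.single 0 (a 1), Finsupp.single 0 (b 1)), ?_, ?_⟩
      · rw [Finset.mem_coe, Finset.HasAntidiagonal.mem_antidiagonal, ← Finsupp.single_add, ← hab]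
        rfl
      · have h0 := DFunLike.congr_fun hab 0
        simp only [Finsupp.add_apply, hb, add_zero] at h0
        rw [Prod.mk.injEq]
        constructor
        · ext i; fin_cases i <;> simp [h0]
        · ext i; fin_cases i <;> simp [hb]
    · rw [mul_zero]
  · rintro ⟨a, b⟩ -
    dsimp only
    rw [coeff_inSecond, coeff_polySeries, hA _ (by simp), if_pos (by simp)]
    simp only [Finsupp.add_apply, Finsupp.single_eq_same]
    rw [← exp_one_eq b]
    simp

/-- The series `γ(x₂)` does not involve `x₁`, so the powers of `x₁` do not mix: the part in `x₁ ^ k`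
is `p_k(x₂, γ(x₂))`. -/
lemma coeff_eval_inSecond {K : Type*} [Field K] {p : ℕ → Polynomial (Polynomial K)}
    {P : Polynomial (MvPowerSeries (Fin 2) K)}
    (hP : ∀ j (m : Fin 2 →₀ ℕ), coeff m (P.coeff j) = ((p (m 0)).coeff j).coeff (m 1))
    (γ : MvPowerSeries (Fin 1) K) (m : Fin 2 →₀ ℕ) :
    coeff m (P.eval (inSecond γ)) =
      coeff (Finsupp.single 0 (m 1)) ((p (m 0)).eval₂ (polySeries K) γ) := by
  have hdeg : (p (m 0)).natDegree < P.natDegree + 1 := by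
    rw [Nat.lt_succ_iff, Polynomial.natDegree_le_iff_coeff_eq_zero]
    intro N hN
    ext l
    have := hP N (Finsupp.single 0 (m 0) + Finsupp.single 1 l)
    rw [Polynomial.coeff_eq_zero_of_natDegree_lt hN] at this
    simpa using this.symm
  rw [Polynomial.eval_eq_sum_range' (Nat.lt_succ_self _),
    Polynomial.eval₂_eq_sum_range' _ hdeg, map_sum, map_sum]
  refine Finset.sum_congr rfl fun j _ => ?_
  have : inSecond γ ^ j = inSecond (γ ^ j) := (map_pow (rename _) γ j).symm
  rw [this]
  refine coeff_mul_inSecond _ _ _ _ fun e he => ?_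
  rw [hP, he]

/-- The integral closure of a subring of a field is the intersection of the valuation rings
containing it. -/
lemma mem_integralClosure_of_forall_valuationSubring {O K : Type*} [CommRing O]
    [Field K] [Algebra O K] {f : O} {x : K}
    (h : ∀ V : ValuationSubring K, (∀ y ∈ locAway O K f, y ∈ V) → x ∈ V) :
    IsIntegral (locAway O K f) x := by
  have h1 : x ∈ (⨅ V : {V : ValuationSubring K // (locAway O K f : Set K) ⊆ V.toSubring},
      V.1.toSubring) := by
    rw [Subring.mem_iInf]
    exact fun V => h V.1 V.2
  rw [iInf_valuationSubring_superset] at h1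
  have hle : Subring.closure (locAway O K f : Set K) ≤ (locAway O K f).toSubring :=
    Subring.closure_le.2 le_rfl
  obtain ⟨p, hp, hpx⟩ := h1
  exact ⟨p.map (Subring.inclusion hle), hp.map _, by rw [Polynomial.eval₂_map]; exact hpx⟩

variable {O K : Type*} [CommRing O] [IsDomain O] [Field K] [Algebra O K]
variable (L : Type*) [Field L] [CharZero L] [Algebra O L] [IsFractionRing O L] [Algebra L K]
  [Algebra.IsAlgebraic L K] [IsScalarTower O L K]

include L in
lemma exists_common_subalgebra {α : Type*} [Finite α] {n : ℕ} {F : α → MvPowerSeries (Fin n) K}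
    (hF : ∀ a, F a ∈ eisensteinSeries O K n) :
    ∃ B : Subalgebra O K, B.FG ∧ ∀ a m, coeff m (F a) ∈ B := by
  choose B hB hFB using fun a => (mem_eisensteinSeries_iff L).1 (hF a)
  choose T hT hTB using fun a => Subalgebra.fg_def.1 (hB a)
  refine ⟨Algebra.adjoin O (⋃ a, T a), Subalgebra.fg_def.2 ⟨_, Set.finite_iUnion hT, rfl⟩,
    fun a m => ?_⟩
  have h1 := hFB a m
  rw [← hTB] at h1
  exact Algebra.adjoin_mono (Set.subset_iUnion T a) h1

include L in
/-- Let `Γ` be irreducible with all its roots Eisenstein series. Polynomials `r k` of degree less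
than that of `Γ` have coefficients in a common finitely generated algebra if their values at some
root of `Γ` do. -/
theorem exists_fg_coeff_mem [IsIntegrallyClosed O] {ι : Type*} [Fintype ι]
    {Γ : Polynomial (Polynomial K)} (hirr : Irreducible Γ) (hΓ : Γ.Monic)
    {γ : ι → MvPowerSeries (Fin 1) K} (hγ : ∀ i, γ i ∈ eisensteinSeries O K 1)
    (hprod : Γ.map (polySeries K) = partialProd γ Finset.univ)
    {g : MvPowerSeries (Fin 1) K} (hgE : g ∈ eisensteinSeries O K 1)
    (hg : Γ.eval₂ (polySeries K) g = 0)
    {r : ℕ → Polynomial (Polynomial K)} (hr : ∀ k, (r k).degree < Γ.degree)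
    {B : Subalgebra O K} (hB : B.FG)
    (hrg : ∀ k m, coeff m ((r k).eval₂ (polySeries K) g) ∈ B) :
    ∃ B' : Subalgebra O K, B'.FG ∧ ∀ k j l, ((r k).coeff j).coeff l ∈ B' := by
  classical
  set D := Γ.support.sup fun j => (Γ.coeff j).natDegree with hDdef
  have hD : ∀ j, (Γ.coeff j).natDegree ≤ D := by
    intro j
    by_cases hj : Γ.coeff j = 0
    · simp [hj]
    · exact Finset.le_sup (f := fun j => (Γ.coeff j).natDegree) (Polynomial.mem_support_iff.2 hj)
  -- For each proper nonempty `S`, the inverse of one nonzero coefficient beyond `D` is recorded, so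
  -- that this coefficient becomes a unit in the valuation rings below; `0` is a dummy value for the
  -- other `S`.
  have hS : ∀ S : Finset ι, ∃ b : K, S.Nonempty → S ≠ Finset.univ →
      ∃ j m, D < m 0 ∧ coeff m ((partialProd γ S).coeff j) ≠ 0 ∧
        b = (coeff m ((partialProd γ S).coeff j))⁻¹ := by
    intro S
    by_cases h1 : S.Nonempty ∧ S ≠ Finset.univ
    · obtain ⟨j, m, hm, hne⟩ := exists_coeff_partialProd_ne_zero hirr hΓ hprod D h1.1 h1.2
      exact ⟨_, fun _ _ => ⟨j, m, hm, hne, rfl⟩⟩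
    · exact ⟨0, fun h2 h3 => absurd ⟨h2, h3⟩ h1⟩
  choose b hb using hS
  obtain ⟨B₁, hB₁, hγB⟩ := exists_common_subalgebra L hγ
  obtain ⟨B₂, hB₂, hgB⟩ := (mem_eisensteinSeries_iff L).1 hgE
  have hB₃ : (Algebra.adjoin O (Set.range b)).FG :=
    Subalgebra.fg_def.2 ⟨_, Set.finite_range b, rfl⟩
  obtain ⟨f, c, hf, hc, hle⟩ := exists_le_awayAdjoin L (((hB.sup hB₁).sup hB₂).sup hB₃)
  have hle0 : B ≤ awayAdjoin O f c := le_trans (le_trans le_sup_left (le_trans le_sup_left le_sup_left)) hle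
  have hle1 : B₁ ≤ awayAdjoin O f c :=
    le_trans (le_trans le_sup_right (le_trans le_sup_left le_sup_left)) hle
  have hle2 : B₂ ≤ awayAdjoin O f c := le_trans (le_trans le_sup_right le_sup_left) hle
  have hle3 : Algebra.adjoin O (Set.range b) ≤ awayAdjoin O f c := le_trans le_sup_right hle
  -- A valuation ring containing `O_f` is integrally closed, so it contains `c` and with it all the
  -- data, including the recorded inverses.
  have hval : ∀ k j l, IsIntegral (locAway O K f) (((r k).coeff j).coeff l) := by
    intro k j l
    refine mem_integralClosure_of_forall_valuationSubring fun V hV => ?_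
    have hcV : c ∈ V := by
      obtain ⟨q, hq, hqc⟩ := hc
      have hOV : ∀ a : O, algebraMap O K a ∈ V := fun a => hV _ (Subalgebra.algebraMap_mem _ a)
      have hint : IsIntegral V c := by
        refine ⟨q.map ((algebraMap O K).codRestrict V hOV), hq.map _, ?_⟩
        rw [Polynomial.eval₂_map]
        exact hqc
      obtain ⟨y, hy⟩ := IsIntegrallyClosed.isIntegral_iff.1 hint
      exact hy ▸ y.2
    have hV' : ∀ x ∈ awayAdjoin O f c, x ∈ V := by
      intro x hx
      induction hx using Algebra.adjoin_induction with
      | mem x hx =>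
        rcases hx with rfl | rfl
        · exact hV _ (Algebra.subset_adjoin rfl)
        · exact hcV
      | algebraMap a => exact hV _ (Subalgebra.algebraMap_mem _ a)
      | add x y _ _ hx hy => exact V.add_mem _ _ hx hy
      | mul x y _ _ hx hy => exact V.mul_mem _ _ hx hy
    refine coeff_mem_valuationSubring V hΓ hprod hD (fun i m => hV' _ (hle1 (hγB i m))) ?_ hg
      (fun m => hV' _ (hle2 (hgB m))) (hr k) (fun m => hV' _ (hle0 (hrg k m))) j l
    intro S hS1 hS2
    obtain ⟨j, m, hm, hne, hbS⟩ := hb S hS1 hS2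
    exact ⟨j, m, hm, hne, hbS ▸ hV' _ (hle3 (Algebra.subset_adjoin ⟨S, rfl⟩))⟩
  -- Integrality alone does not give a finitely generated algebra; all the coefficients must also
  -- lie in one finite extension of `L`.
  let E := IntermediateField.adjoin L {c}
  have hfd : FiniteDimensional L E :=
    IntermediateField.adjoin.finiteDimensional (Algebra.IsIntegral.isIntegral c)
  have hE : ∀ x ∈ awayAdjoin O f c, x ∈ E := by
    have hOE : ∀ a : O, algebraMap O K a ∈ E := fun a => by
      rw [IsScalarTower.algebraMap_apply O L K]; exact E.algebraMap_mem _
    intro x hx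
    induction hx using Algebra.adjoin_induction with
    | mem x hx =>
      rcases hx with rfl | rfl
      · exact E.inv_mem (hOE f)
      · exact IntermediateField.mem_adjoin_simple_self L _
    | algebraMap a => exact hOE a
    | add x y _ _ hx hy => exact E.add_mem hx hy
    | mul x y _ _ hx hy => exact E.mul_mem hx hy
  obtain ⟨B', hB', hmem⟩ := exists_fg_of_isIntegral_locAway L hf E
  refine ⟨B', hB', fun k j l => hmem _ ?_ (hval k j l)⟩
  have hdeg : Γ.degree = (Γ.natDegree : ℕ) := Polynomial.degree_eq_natDegree hΓ.ne_zero
  refine coeff_mem_subfield E (fun m => hE _ (hle2 (hgB m))) (N := Γ.natDegree) ?_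
    (hdeg ▸ hr k) (fun m => hE _ (hle0 (hrg k m))) j l
  intro p hp hpg
  exact eq_zero_of_eval₂_eq_zero hΓ hprod hD
    (fun S h1 h2 => exists_coeff_partialProd_ne_zero hirr hΓ hprod D h1 h2) hg (hdeg ▸ hp) hpg

-- Modulo `Γ` each `p_k` may be replaced by its remainder, with the same values at both roots. The
-- value at `γ` controls the coefficients of the remainders, and these control the value at `γ'`.
include L in
theorem eisensteinSeries_temperate [IsIntegrallyClosed O] (Γ : Polynomial (Polynomial K))
    (hirr : Irreducible Γ) (hΓ : Γ.Monic)
    (hsplit : ∃ s : Multiset (MvPowerSeries (Fin 1) K), (∀ g ∈ s, g ∈ eisensteinSeries O K 1) ∧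
      Γ.map (polyToSeries K) = (s.map fun g => Polynomial.X - Polynomial.C g).prod)
    (γ : MvPowerSeries (Fin 1) K) (hγ : γ ∈ eisensteinSeries O K 1)
    (γ' : MvPowerSeries (Fin 1) K) (hγ' : γ' ∈ eisensteinSeries O K 1)
    (hroot : Γ.eval₂ (polyToSeries K) γ = 0) (hroot' : Γ.eval₂ (polyToSeries K) γ' = 0)
    (p : ℕ → Polynomial (Polynomial K)) (P : Polynomial (MvPowerSeries (Fin 2) K))
    (hP : ∀ j (m : Fin 2 →₀ ℕ), coeff m (P.coeff j) = ((p (m 0)).coeff j).coeff (m 1))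
    (h : P.eval (inSecond γ) ∈ eisensteinSeries O K 2) :
    P.eval (inSecond γ') ∈ eisensteinSeries O K 2 := by
  classical
  rw [polyToSeries_eq] at hroot hroot' hsplit
  obtain ⟨s, hs, hprod⟩ := hsplit
  obtain ⟨l, rfl⟩ := Quot.exists_rep s
  have hprod' : Γ.map (polySeries K) = partialProd (fun i : Fin l.length => l.get i) Finset.univ := by
    rw [hprod, partialProd]
    change (Multiset.map (fun g => Polynomial.X - Polynomial.C g) (Multiset.ofList l)).prod = _
    rw [Multiset.map_coe, Multiset.prod_coe, ← List.prod_ofFn]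
    congr 1
    exact (List.ofFn_getElem_eq_map l _).symm
  obtain ⟨B, hB, hPB⟩ := (mem_eisensteinSeries_iff L).1 h
  have hmod : ∀ k, ∀ g : MvPowerSeries (Fin 1) K, Γ.eval₂ (polySeries K) g = 0 →
      (p k %ₘ Γ).eval₂ (polySeries K) g = (p k).eval₂ (polySeries K) g := fun k g hg =>
    Polynomial.eval₂_modByMonic_eq_self_of_root hg
  obtain ⟨B', hB', hB'p⟩ := exists_fg_coeff_mem L hirr hΓ
    (fun i : Fin l.length => hs _ (List.get_mem l i)) hprod' hγ hroot
    (r := fun k => p k %ₘ Γ) (fun k => Polynomial.degree_modByMonic_lt _ hΓ) hB (by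
    intro k m
    rw [hmod k γ hroot]
    have := hPB (Finsupp.single 0 k + Finsupp.single 1 (m 0))
    rw [coeff_eval_inSecond hP] at this
    rw [exp_one_eq m]
    simpa using this)
  obtain ⟨B₂, hB₂, hγ'B⟩ := (mem_eisensteinSeries_iff L).1 hγ'
  refine (mem_eisensteinSeries_iff L).2 ⟨B' ⊔ B₂, hB'.sup hB₂, fun m => ?_⟩
  rw [coeff_eval_inSecond hP, ← hmod _ γ' hroot', Polynomial.eval₂_eq_sum_range, map_sum]
  have hpow : ∀ i m, coeff m (γ' ^ i) ∈ B' ⊔ B₂ := by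
    intro i
    induction i with
    | zero =>
      intro m
      rw [pow_zero, ← map_one C]
      exact coeff_C_mem (Subalgebra.one_mem _) m
    | succ i ih =>
      rw [pow_succ]
      exact coeff_mul_mem ih fun m => le_sup_right (a := B') (hγ'B m)
  refine Subalgebra.sum_mem _ fun i _ => coeff_mul_mem (fun e => ?_) (hpow i) _
  rw [coeff_polySeries]
  exact le_sup_left (a := B') (hB'p _ _ _)

end Temperate

/-! ### The W-temperate family -/

section WTemperate

variable (k : Type*) {O K : Type*} [Field k] [Uncountable k] [CommRing O] [IsDomain O]
  [UniqueFactorizationMonoid O] [Algebra k O] [Field K] [Algebra O K] [IsAlgClosed K]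
variable (L : Type*) [Field L] [CharZero L] [Algebra O L] [IsFractionRing O L] [Algebra L K]
  [Algebra.IsAlgebraic L K] [IsScalarTower O L K]

include k L in
theorem isWTemperateFamily_eisensteinSeries :
    IsWTemperateFamily K (eisensteinSeries O K) where
  toIsWeierstrassFamily := isWeierstrassFamily_eisensteinSeries L
  uncountable :=
    ((algebraMap_injective_of_tower (O := O) (K := K) L).comp
      (algebraMap k O).injective).uncountable
  isAlgClosed := inferInstance
  blowDown_mem n f hf := by
    obtain ⟨B, hB, h⟩ := (mem_eisensteinSeries_iff L).1 hf
    exact (mem_eisensteinSeries_iff L).2 ⟨B, hB, fun m => coeff_blowDown f m ▸ h _⟩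
  hyperplane n F hF hcount := by
    have hinj : Function.Injective fun a : k => algebraMap O K (algebraMap k O a) :=
      (algebraMap_injective_of_tower L).comp (algebraMap k O).injective
    -- If the bad slopes in `K` were countable, so would be those in `k`; the good slopes in `k` are
    -- countable as well, contradicting the uncountability of `k`.
    have h1 := countable_hyperplaneSection_mem (k := k) L hF
    have h2 := hcount.preimage hinj
    have h3 := h1.union h2
    refine Set.not_countable_univ (α := k) (h3.mono fun a _ => ?_)
    by_cases ha : hyperplaneSection (algebraMap O K (algebraMap k O a)) F ∈
        eisensteinSeries O K (n + 1)
    · exact Or.inl ha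
    · exact Or.inr ha
  temperate _ _ Γ hirr hΓ hsplit γ hγ γ' hγ' hroot hroot' p P _ hP h :=
    eisensteinSeries_temperate L Γ hirr hΓ hsplit γ hγ γ' hγ' hroot hroot' p P hP h

end WTemperate

end WFamily

open WFamily in
/-- The Eisenstein series form a W-temperate family; Weierstrass division keeps the coefficients
in `O_g[c]` as soon as the leading coefficient `u(0)` of the divisor is a unit of `O_g[c]`, which
holds for some nonzero multiple `g` of `f`; and only countably many slopes in `k` are bad. -/
theorem mainTheorem4 (k O L K : Type*) [Field k] [CharZero k] [Uncountable k]
    [CommRing O] [IsDomain O] [UniqueFactorizationMonoid O] [Algebra k O]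
    [Field L] [Algebra O L] [IsFractionRing O L]
    [Field K] [Algebra L K] [IsAlgClosure L K] [Algebra O K] [IsScalarTower O L K] :
    IsWTemperateFamily K (eisensteinSeries O K) ∧
    (∀ (n d : ℕ) (c : K) (f : O), f ≠ 0 → ∀ F ∈ eisensteinAt O K (n + 1) f c,
      ∀ u : PowerSeries K, PowerSeries.constantCoeff u ≠ 0 →
        restrictLast F = PowerSeries.X ^ d * u →
      (∃ g : O, g ≠ 0 ∧ f ∣ g ∧
        ∃ v ∈ locAwayAdjoin O K g c, PowerSeries.constantCoeff u * v = 1) ∧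
      (∀ g : O, g ≠ 0 → f ∣ g →
        (∃ v ∈ locAwayAdjoin O K g c, PowerSeries.constantCoeff u * v = 1) →
        ∀ G ∈ eisensteinAt O K (n + 1) g c,
          ∃ (Q : MvPowerSeries (Fin (n + 1)) K) (R : Polynomial (MvPowerSeries (Fin n) K)),
            (∀ m, MvPowerSeries.coeff m Q ∈ locAwayAdjoin O K g c) ∧
            (∀ i m, MvPowerSeries.coeff m (R.coeff i) ∈ locAwayAdjoin O K g c) ∧
            R.degree < d ∧ G = F * Q + polyInLast K n R ∧
            ∀ (Q' : MvPowerSeries (Fin (n + 1)) K) (R' : Polynomial (MvPowerSeries (Fin n) K)),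
              R'.degree < d → G = F * Q' + polyInLast K n R' → Q' = Q ∧ R' = R)) ∧
    (∀ (n : ℕ) (F : MvPowerSeries (Fin (n + 2)) K), F ∉ eisensteinSeries O K (n + 2) →
      {a : k | hyperplaneSection (algebraMap O K (algebraMap k O a)) F ∈
        eisensteinSeries O K (n + 1)}.Countable) := by
  have : CharZero O := charZero_of_injective_algebraMap (algebraMap k O).injective
  have : CharZero L := charZero_of_injective_algebraMap (IsFractionRing.injective O L)
  have : IsAlgClosed K := IsAlgClosure.isAlgClosed L
  have : Algebra.IsAlgebraic L K := IsAlgClosure.isAlgebraic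
  exact ⟨isWTemperateFamily_eisensteinSeries k L, eisenstein_division L,
    fun _ _ hF => countable_hyperplaneSection_mem L hF⟩
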